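/- **Setting.** For a finite graph $\mathcal G=(V,E)$ and $\beta>0$, the Ising model on $\mathcal G$ assigns to $\sigma\in\{-1,+1\}^V$ the probability $\frac{1}{Z^{\mathcal G}_\beta}\exp\big(\beta\sum_{xy\in E}\sigma_x\sigma_y\big)$, where $Z^{\mathcal G}_\beta$ is the normalising constant; write $\langle\cdot\rangle_\beta^{\mathcal G}$ for its expectation. Let $d\ge1$. For an integer $R\ge1$ let $\Lambda_R=[-R/2,R/2)^d\cap\mathbb Z^d$ with its nearest-neighbour edges, and for an integer $r\ge3$ let $\mathbb T_r=(\mathbb Z/r\mathbb Z)^d$ with its nearest-neighbour edges. Let $\pi:\mathbb Z^d\to\mathbb T_r$ be the projection, identify $x\in\mathbb T_r$ with its representative in $\Lambda_r$, and write $x\cong x'$ if $x-x'\in r\mathbb Z^d$. Put $$\tau_\beta^{\mathbb T_r}(x)=\langle\sigma_0\sigma_x\rangle_\beta^{\mathbb T_r}\quad(x\in\mathbb T_r),\qquad \tau_\beta(x)=\lim_{R\to\infty}\langle\sigma_0\sigma_x\rangle_\beta^{\Lambda_R}\quad(x\in\mathbb Z^d),\qquad T_\beta^{(r)}(x)=\sum_{u\in\mathbb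 Z^d}\tau_\beta(x+ru).$$ (The limit exists, and all two-point functions are nonnegative, by the Griffiths inequalities.) Infinite sums take values in $[0,\infty]$, and $\infty-a=\infty$ for finite $a$. **Theorem 2.1.** Let $d\ge1$, $r\ge3$ and $\beta>0$. For any $x\in\mathbb T_r$, $$\tau_\beta^{\mathbb T_r}(x)\le T_\beta^{(r)}(x),$$ $$T_\beta^{(r)}(x)-\tau_\beta^{\mathbb T_r}(x)\le\sum_{x'\cong x}\ \sum_{y}\ \sum_{\substack{y'\cong y\\ y'\ne y}}\ \sum_{z}\ \tau_\beta(z)\,\tau_\beta(y-z)\,\tau_\beta(y'-z)\,\tau_\beta^{\mathbb T_r}(\pi y'-\pi z)\,\tau_\beta(x'-y),$$ where $x',y,y',z$ range over $\mathbb Z^d$ with the indicated restrictions. -/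

import Mathlib

open Filter
open scoped BigOperators ENNReal

noncomputable section

namespace IsingTorus

/-! ### The Ising model on a finite graph -/

section FiniteGraph

variable {V : Type*} [Fintype V]

/-- Product `σ_x σ_y` of the two spins at the end points of an edge `e = xy`. -/
def edgeSpin (σ : V → ℤˣ) (e : Sym2 V) : ℝ :=
  Sym2.lift ⟨fun x y => ((σ x : ℤ) : ℝ) * ((σ y : ℤ) : ℝ), fun _ _ => mul_comm _ _⟩ e

open Classical in
/-- The Hamiltonian `H(σ) = - ∑_{xy ∈ E} σ_x σ_y` (each unordered edge counted once). -/
def hamiltonian (G : SimpleGraph V) (σ : V → ℤˣ) : ℝ :=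
  -∑ e ∈ G.edgeFinset, edgeSpin σ e

open Classical in
/-- The partition function; a spin configuration is a map `V → ℤˣ = {1, -1}`. -/
def partitionFunction (G : SimpleGraph V) (β : ℝ) : ℝ :=
  ∑ σ : V → ℤˣ, Real.exp (-β * hamiltonian G σ)

open Classical in
/-- The Ising expectation `⟨F⟩` on the finite graph `G` at inverse temperature `β`. -/
def expectation (G : SimpleGraph V) (β : ℝ) (F : (V → ℤˣ) → ℝ) : ℝ :=
  (1 / partitionFunction G β) * ∑ σ : V → ℤˣ, F σ * Real.exp (-β * hamiltonian G σ)

/-- The two-point function `⟨σ_x σ_y⟩` on the finite graph `G`. -/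
def twoPoint (G : SimpleGraph V) (β : ℝ) (x y : V) : ℝ :=
  expectation G β fun σ => ((σ x : ℤ) : ℝ) * ((σ y : ℤ) : ℝ)

end FiniteGraph

/-! ### Boxes, the torus, and infinite volume -/

/-- The nearest-neighbour graph on `A^d`: distinct points that differ by a standard unit vector.
It is used for `A = ℤ` (the lattice) and `A = ℤ/rℤ` (the torus). -/
def nnGraph (A : Type*) [CommRing A] (d : ℕ) : SimpleGraph (Fin d → A) :=
  SimpleGraph.fromRel fun x y => ∃ i : Fin d, y = x + Pi.single i 1

/-- The box `Λ_R = [-R/2, R/2)^d ∩ ℤ^d`. -/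
def box (d R : ℕ) : Finset (Fin d → ℤ) :=
  Fintype.piFinset fun _ => Finset.Ico ⌈-(R : ℝ) / 2⌉ ⌈(R : ℝ) / 2⌉

theorem mem_box {d R : ℕ} {x : Fin d → ℤ} :
    x ∈ box d R ↔ ∀ i, -(R : ℝ) / 2 ≤ (x i : ℝ) ∧ (x i : ℝ) < (R : ℝ) / 2 := by
  simp only [box, Fintype.mem_piFinset, Finset.mem_Ico, Int.ceil_le, Int.lt_ceil]

/-- The box with its nearest-neighbour edges (free boundary conditions). -/
def boxGraph (d R : ℕ) : SimpleGraph (box d R) :=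
  (nnGraph ℤ d).comap Subtype.val

open Classical in
/-- The two-point function of the box `Λ_R` with free boundary conditions, set to `0` when one of
the points lies outside of the box. -/
def boxTwoPoint (d R : ℕ) (β : ℝ) (x y : Fin d → ℤ) : ℝ :=
  if h : x ∈ box d R ∧ y ∈ box d R then twoPoint (boxGraph d R) β ⟨x, h.1⟩ ⟨y, h.2⟩ else 0

/-- The infinite-volume two-point function `τ_β(x) = lim_{R → ∞} τ_β^{Λ_R}(0, x)`. -/
def tau (d : ℕ) (β : ℝ) (x : Fin d → ℤ) : ℝ :=
  limUnder atTop fun R : ℕ => boxTwoPoint d R β 0 x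

/-- The torus two-point function `τ_β^{𝕋_r}(a) = ⟨σ_0 σ_a⟩`, for `a ∈ (ℤ/rℤ)^d`. -/
def torusTau (d r : ℕ) [NeZero r] (β : ℝ) (a : Fin d → ZMod r) : ℝ :=
  twoPoint (nnGraph (ZMod r) d) β 0 a

/-- The projection `π : ℤ^d → (ℤ/rℤ)^d`. -/
def proj (d r : ℕ) (x : Fin d → ℤ) : Fin d → ZMod r :=
  fun i => (x i : ZMod r)

/-- `x ≅ x'` if `x - x' ∈ r ℤ^d`. -/
def Equivalent {d : ℕ} (r : ℕ) (x x' : Fin d → ℤ) : Prop :=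
  ∃ u : Fin d → ℤ, x - x' = (r : ℤ) • u

/-- The unfolded sum `T_β^{(r)}(x) = ∑_{u ∈ ℤ^d} τ_β(x + r u)`, with values in `[0, ∞]`. -/
def unfolded (d r : ℕ) (β : ℝ) (x : Fin d → ℤ) : ℝ≥0∞ :=
  ∑' u : Fin d → ℤ, ENNReal.ofReal (tau d β (x + (r : ℤ) • u))

end IsingTorus

end

/-!
If `r ∣ M`, the torus `𝕋_M` covers `𝕋_r`. Take independent Ising systems on the two and explore
them jointly from the origin: an edge of the cover and its projection are revealed together,
through `(1 + tA) (1 + tB) = (1 - t²) + t (1 + AB) (t + A)` with `t = tanh β`, so that the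
products of the two spins agree along the edges found open. When no such pair of edges is left
at the explored vertices, `σ_0 σ_x` on `𝕋_r` averages to zero unless some explored vertex lies
above `x`, and in that case it agrees with `σ_0 σ_w` for this vertex `w`. Summing over the fibre
gives `τ^{𝕋_r}(x) ≤ ∑ τ^{𝕋_M}(w)`. The two sides differ only through vertices of the cover whose
fibre contains another explored vertex, and the inequalities of Griffiths and Simon bound the
difference by the error term of the theorem, with `τ^{𝕋_M}` in place of `τ_β`.

Now let `M → ∞`. If `∑ τ_β` is finite, Simon's inequality for a large box shows that `τ^{𝕋_M}`
is the push-forward of `τ_β` up to a small total mass. If it is infinite, then `τ_β(x + y) ≥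
τ_β(x) τ_β(y) > 0` shows that both right-hand sides are infinite.
-/

noncomputable section

namespace IsingTorus

section Characters

variable {Ω : Type*} [CommGroup Ω]

/-- The real function `ω ↦ χ(ω) ∈ {1, -1}` of a sign character. A spin system is described below by
a group `Ω` of configurations and a family of sign characters, its spins, so that several systems
can live on the same `Ω`. -/
def sgn (χ : Ω →* ℤˣ) (ω : Ω) : ℝ := ((χ ω : ℤ) : ℝ)

theorem sgn_mul (χ ψ : Ω →* ℤˣ) : sgn (χ * ψ) = sgn χ * sgn ψ := by
  ext ω; simp [sgn]

theorem sgn_one : sgn (1 : Ω →* ℤˣ) = 1 := by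
  ext ω; simp [sgn]

theorem sgn_apply_mul (χ : Ω →* ℤˣ) (ω ρ : Ω) : sgn χ (ω * ρ) = sgn χ ω * sgn χ ρ := by
  simp [sgn]

theorem sgn_eq_one_or (χ : Ω →* ℤˣ) (ω : Ω) : sgn χ ω = 1 ∨ sgn χ ω = -1 := by
  rcases Int.units_eq_one_or (χ ω) with h | h <;> simp [sgn, h]

theorem sgn_le_one (χ : Ω →* ℤˣ) (ω : Ω) : sgn χ ω ≤ 1 := by
  rcases sgn_eq_one_or χ ω with h | h <;> simp [h]

theorem char_mul_self (χ : Ω →* ℤˣ) : χ * χ = 1 :=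
  MonoidHom.ext fun ω => Int.units_mul_self (χ ω)

theorem char_mul_mul_mul_cancel (χ ψ φ : Ω →* ℤˣ) : χ * ψ * (ψ * φ) = χ * φ := by
  rw [mul_assoc, ← mul_assoc ψ, char_mul_self, one_mul]

theorem sgn_mul_self (χ : Ω →* ℤˣ) : sgn χ * sgn χ = 1 := by
  rw [← sgn_mul, char_mul_self, sgn_one]

theorem one_add_sgn_mul_self (χ : Ω →* ℤˣ) : (1 + sgn χ) * sgn χ = 1 + sgn χ := by
  rw [add_mul, one_mul, sgn_mul_self, add_comm]

variable (Ω) in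
/-- The nonnegative multiples of characters. -/
def characterMonomials : Submonoid (Ω → ℝ) where
  carrier := {f | ∃ c : ℝ, 0 ≤ c ∧ ∃ χ : Ω →* ℤˣ, f = c • sgn χ}
  one_mem' := ⟨1, zero_le_one, 1, by rw [sgn_one, one_smul]⟩
  mul_mem' := by
    rintro _ _ ⟨c, hc, χ, rfl⟩ ⟨c', hc', χ', rfl⟩
    exact ⟨c * c', mul_nonneg hc hc', χ * χ', by rw [sgn_mul, smul_mul_smul_comm]⟩

variable (Ω) in
/-- The functions with nonnegative Fourier coefficients. -/
def griffithsCone : Subsemiring (Ω → ℝ) := (characterMonomials Ω).subsemiringClosure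

theorem smul_sgn_mem_griffithsCone {c : ℝ} (hc : 0 ≤ c) (χ : Ω →* ℤˣ) :
    c • sgn χ ∈ griffithsCone Ω :=
  AddSubmonoid.subset_closure ⟨c, hc, χ, rfl⟩

theorem sgn_mem_griffithsCone (χ : Ω →* ℤˣ) : sgn χ ∈ griffithsCone Ω := by
  simpa only [one_smul] using smul_sgn_mem_griffithsCone zero_le_one χ

theorem const_mem_griffithsCone {c : ℝ} (hc : 0 ≤ c) : (fun _ => c) ∈ griffithsCone Ω := by
  have := smul_sgn_mem_griffithsCone hc (1 : Ω →* ℤˣ)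
  rwa [sgn_one, ← Algebra.algebraMap_eq_smul_one] at this

theorem smul_mem_griffithsCone {c : ℝ} (hc : 0 ≤ c) {F : Ω → ℝ} (hF : F ∈ griffithsCone Ω) :
    c • F ∈ griffithsCone Ω :=
  mul_mem (const_mem_griffithsCone hc) hF

theorem affine_mem_griffithsCone {c d : ℝ} (hc : 0 ≤ c) (hd : 0 ≤ d) (χ : Ω →* ℤˣ) :
    (fun ω => c + d * sgn χ ω) ∈ griffithsCone Ω :=
  add_mem (const_mem_griffithsCone hc) (smul_sgn_mem_griffithsCone hd χ)

variable [Fintype Ω]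

theorem sum_sgn_mul_eq_zero {χ : Ω →* ℤˣ} {g : Ω} (hχ : χ g = -1) {F : Ω → ℝ}
    (hF : ∀ ω, F (g * ω) = F ω) : ∑ ω, sgn χ ω * F ω = 0 := by
  have htranslate : ∑ ω, sgn χ ω * F ω = ∑ ω, sgn χ (g * ω) * F (g * ω) :=
    (Equiv.sum_comp (Equiv.mulLeft g) fun ω => sgn χ ω * F ω).symm
  have hg : sgn χ g = -1 := by simp [sgn, hχ]
  simp only [sgn_apply_mul, hg, hF, neg_mul, one_mul, Finset.sum_neg_distrib] at htranslate
  linarith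

theorem sum_sgn_nonneg (χ : Ω →* ℤˣ) : 0 ≤ ∑ ω, sgn χ ω := by
  by_cases h : ∃ g, χ g = -1
  · obtain ⟨g, hg⟩ := h
    simpa using (sum_sgn_mul_eq_zero hg (F := 1) fun _ => rfl).ge
  · push Not at h
    refine Finset.sum_nonneg fun ω _ => ?_
    simp [sgn, (Int.units_eq_one_or (χ ω)).resolve_right (h ω)]

theorem sum_nonneg_of_mem_griffithsCone {F : Ω → ℝ} (hF : F ∈ griffithsCone Ω) :
    0 ≤ ∑ ω, F ω := by
  refine AddSubmonoid.closure_induction (motive := fun F _ => 0 ≤ ∑ ω, F ω) ?_ ?_ ?_ hF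
  · rintro _ ⟨c, hc, χ, rfl⟩
    simpa only [Pi.smul_apply, ← Finset.smul_sum] using smul_nonneg hc (sum_sgn_nonneg χ)
  · simp
  · intro f g _ _ hf hg
    simpa [Finset.sum_add_distrib] using add_nonneg hf hg

/-- Ginibre's duplication: the second copy `ω'` of the system is written as `ω * ρ`. -/
theorem sum_mul_sum_sub_sum_mul_sum (F W : Ω → ℝ) (ψ : Ω →* ℤˣ) :
    (∑ ω, (F * sgn ψ * W) ω) * ∑ ω, W ω - (∑ ω, (F * W) ω) * ∑ ω, (sgn ψ * W) ω
      = ∑ ρ, (1 - sgn ψ ρ) * ∑ ω, F ω * sgn ψ ω * (W ω * W (ω * ρ)) := by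
  have htranslate (G : Ω → ℝ) (ω : Ω) : ∑ ρ, G ρ = ∑ ρ, G (ω * ρ) :=
    (Equiv.sum_comp (Equiv.mulLeft ω) G).symm
  conv_rhs => simp only [Finset.mul_sum]
  conv_rhs => rw [Finset.sum_comm]
  rw [Finset.sum_mul, Finset.sum_mul, ← Finset.sum_sub_distrib]
  refine Finset.sum_congr rfl fun ω _ => ?_
  rw [htranslate W ω, htranslate (sgn ψ * W) ω, Finset.mul_sum, Finset.mul_sum,
    ← Finset.sum_sub_distrib]
  refine Finset.sum_congr rfl fun ρ _ => ?_
  simp only [Pi.mul_apply, sgn_apply_mul]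
  ring

theorem griffiths_second {F W : Ω → ℝ} (hF : F ∈ griffithsCone Ω)
    (hW : ∀ ρ, (fun ω => W ω * W (ω * ρ)) ∈ griffithsCone Ω) (ψ : Ω →* ℤˣ) :
    (∑ ω, (F * W) ω) * ∑ ω, (sgn ψ * W) ω ≤ (∑ ω, (F * sgn ψ * W) ω) * ∑ ω, W ω := by
  rw [← sub_nonneg, sum_mul_sum_sub_sum_mul_sum]
  exact Finset.sum_nonneg fun ρ _ => mul_nonneg (sub_nonneg.2 (sgn_le_one ψ ρ))
    (sum_nonneg_of_mem_griffithsCone (mul_mem (mul_mem hF (sgn_mem_griffithsCone ψ)) (hW ρ)))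

end Characters

section Correlations

variable {Ω : Type*} [CommGroup Ω] {V : Type*} (σ : V → Ω →* ℤˣ) {t : ℝ}

/-- The product of the two spins at the end points of an edge. -/
def edgeChar (e : Sym2 V) : Ω →* ℤˣ :=
  Sym2.lift ⟨fun x y => σ x * σ y, fun _ _ => mul_comm _ _⟩ e

theorem edgeChar_mk (x y : V) : edgeChar σ s(x, y) = σ x * σ y := rfl

/-- The high-temperature weight `∏ (1 + t σ_x σ_y)` of the edges `xy ∈ E`. It is the Gibbs weight up
to a constant if `t = tanh β`. -/
def weight (t : ℝ) (E : Finset (Sym2 V)) (ω : Ω) : ℝ := ∏ e ∈ E, (1 + t * sgn (edgeChar σ e) ω)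

theorem weight_eq_sdiff_mul [DecidableEq (Sym2 V)] (t : ℝ) {D E : Finset (Sym2 V)} (h : D ⊆ E) :
    weight σ t E = weight σ t (E \ D) * weight σ t D :=
  funext fun _ => (Finset.prod_sdiff h).symm

theorem weight_eq_mul_erase [DecidableEq (Sym2 V)] (t : ℝ) {E : Finset (Sym2 V)} {a u : V}
    (he : s(a, u) ∈ E) :
    weight σ t E = (1 + t • sgn (σ a * σ u)) * weight σ t (E.erase s(a, u)) :=
  funext fun _ => (Finset.mul_prod_erase E _ he).symm

theorem weight_mem_griffithsCone (ht0 : 0 ≤ t) (E : Finset (Sym2 V)) :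
    weight σ t E ∈ griffithsCone Ω := by
  have hprod : weight σ t E = ∏ e ∈ E, fun ω => 1 + t * sgn (edgeChar σ e) ω := by
    ext ω; simp [weight]
  rw [hprod]
  exact prod_mem fun e _ => affine_mem_griffithsCone zero_le_one ht0 _

theorem weight_mul_translate_mem_griffithsCone (ht : t ∈ Set.Icc (0 : ℝ) 1) (E : Finset (Sym2 V))
    (ρ : Ω) : (fun ω => weight σ t E ω * weight σ t E (ω * ρ)) ∈ griffithsCone Ω := by
  obtain ⟨ht0, ht1⟩ := ht
  have hprod : (fun ω => weight σ t E ω * weight σ t E (ω * ρ))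
      = ∏ e ∈ E, fun ω => 1 + t ^ 2 * sgn (edgeChar σ e) ρ
        + t * (1 + sgn (edgeChar σ e) ρ) * sgn (edgeChar σ e) ω := by
    ext ω
    rw [Finset.prod_apply, weight, weight, ← Finset.prod_mul_distrib]
    refine Finset.prod_congr rfl fun e _ => ?_
    have hsq : sgn (edgeChar σ e) ω * sgn (edgeChar σ e) ω = 1 := congrFun (sgn_mul_self _) ω
    rw [sgn_apply_mul]
    linear_combination t ^ 2 * sgn (edgeChar σ e) ρ * hsq
  rw [hprod]
  refine prod_mem fun e _ => affine_mem_griffithsCone ?_ ?_ _ <;>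
    rcases sgn_eq_one_or (edgeChar σ e) ρ with h | h <;> rw [h] <;> nlinarith

theorem edgeChar_eq_one {g : Ω} {e : Sym2 V} (h : ∀ v ∈ e, σ v g = 1) : edgeChar σ e g = 1 := by
  induction e with
  | _ x y =>
    rw [edgeChar_mk, MonoidHom.mul_apply, h x (Sym2.mem_mk_left x y),
      h y (Sym2.mem_mk_right x y), one_mul]

theorem edgeChar_eq_one_of_neg {g : Ω} {e : Sym2 V} (h : ∀ v ∈ e, σ v g = -1) :
    edgeChar σ e g = 1 := by
  induction e with
  | _ x y =>
    rw [edgeChar_mk, MonoidHom.mul_apply, h x (Sym2.mem_mk_left x y),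
      h y (Sym2.mem_mk_right x y), neg_mul_neg, one_mul]

theorem weight_mul_of_edgeChar_eq_one {g : Ω} {E : Finset (Sym2 V)}
    (h : ∀ e ∈ E, edgeChar σ e g = 1) (ω : Ω) : weight σ t E (g * ω) = weight σ t E ω :=
  Finset.prod_congr rfl fun e he => by
    rw [sgn_apply_mul, sgn, h e he, Units.val_one, Int.cast_one, one_mul]

/-- `g` reverses the spin at `u` and no other spin. -/
def IsFlip (u : V) (g : Ω) : Prop := σ u g = -1 ∧ ∀ v, v ≠ u → σ v g = 1

variable {σ} in
theorem IsFlip.weight_mul {u : V} {g : Ω} (hg : IsFlip σ u g) {E : Finset (Sym2 V)}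
    (hE : ∀ e ∈ E, u ∉ e) (ω : Ω) : weight σ t E (g * ω) = weight σ t E ω :=
  weight_mul_of_edgeChar_eq_one σ (fun e he => edgeChar_eq_one σ fun v hv =>
    hg.2 v fun h => hE e he (h ▸ hv)) ω

variable {σ} in
theorem IsFlip.mul_apply_eq_neg_one {u : V} {g : Ω} (hg : IsFlip σ u g) {v : V} (hv : v ≠ u) :
    (σ u * σ v) g = -1 := by
  rw [MonoidHom.mul_apply, hg.1, hg.2 v hv, mul_one]

theorem weight_nonneg (ht : t ∈ Set.Icc (0 : ℝ) 1) (E : Finset (Sym2 V)) (ω : Ω) :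
    0 ≤ weight σ t E ω :=
  Finset.prod_nonneg fun e _ => by
    rcases sgn_eq_one_or (edgeChar σ e) ω with h | h <;> rw [h] <;> linarith [ht.1, ht.2]

variable [Fintype Ω]

/-- The unnormalised expectation of `F` for the weight of the edges `E`. -/
def wsum (t : ℝ) (E : Finset (Sym2 V)) (F : Ω → ℝ) : ℝ := ∑ ω, F ω * weight σ t E ω

theorem wsum_add (E : Finset (Sym2 V)) (F G : Ω → ℝ) :
    wsum σ t E (F + G) = wsum σ t E F + wsum σ t E G := by
  simp only [wsum, Pi.add_apply, add_mul, Finset.sum_add_distrib]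

theorem wsum_smul (E : Finset (Sym2 V)) (c : ℝ) (F : Ω → ℝ) :
    wsum σ t E (c • F) = c * wsum σ t E F := by
  simp only [wsum, Pi.smul_apply, smul_eq_mul, mul_assoc, Finset.mul_sum]

theorem wsum_nonneg (ht0 : 0 ≤ t) (E : Finset (Sym2 V)) {F : Ω → ℝ} (hF : F ∈ griffithsCone Ω) :
    0 ≤ wsum σ t E F :=
  sum_nonneg_of_mem_griffithsCone (mul_mem hF (weight_mem_griffithsCone σ ht0 E))

theorem wsum_one_pos (ht : t ∈ Set.Icc (0 : ℝ) 1) (E : Finset (Sym2 V)) : 0 < wsum σ t E 1 := by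
  refine Finset.sum_pos' (fun ω _ => ?_) ⟨1, Finset.mem_univ _, ?_⟩ <;>
    rw [Pi.one_apply, one_mul]
  · exact weight_nonneg σ ht E ω
  · refine Finset.prod_pos fun e _ => ?_
    rw [sgn, map_one, Units.val_one, Int.cast_one]
    linarith [ht.1]

theorem wsum_sdiff [DecidableEq (Sym2 V)] {D E : Finset (Sym2 V)} (h : D ⊆ E) (F : Ω → ℝ) :
    wsum σ t D (F * weight σ t (E \ D)) = wsum σ t E F := by
  simp only [wsum, Pi.mul_apply, weight_eq_sdiff_mul σ t h, mul_assoc]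

theorem wsum_eq_erase_add [DecidableEq (Sym2 V)] {E : Finset (Sym2 V)} {a u : V}
    (he : s(a, u) ∈ E) (F : Ω → ℝ) :
    wsum σ t E F = wsum σ t (E.erase s(a, u)) F
      + t * wsum σ t (E.erase s(a, u)) (F * sgn (σ a * σ u)) := by
  rw [← wsum_smul, ← wsum_add]
  refine Finset.sum_congr rfl fun ω _ => ?_
  simp only [weight_eq_mul_erase σ t he, Pi.mul_apply, Pi.add_apply, Pi.smul_apply, Pi.one_apply,
    smul_eq_mul]
  ring

/-- The correlation of the spins at `a` and `b`. -/
def corr (t : ℝ) (E : Finset (Sym2 V)) (a b : V) : ℝ :=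
  wsum σ t E (sgn (σ a * σ b)) / wsum σ t E 1

theorem corr_comm (E : Finset (Sym2 V)) (a b : V) : corr σ t E a b = corr σ t E b a := by
  rw [corr, mul_comm (σ a), corr]

theorem corr_mul_wsum_one (ht : t ∈ Set.Icc (0 : ℝ) 1) (E : Finset (Sym2 V)) (a b : V) :
    corr σ t E a b * wsum σ t E 1 = wsum σ t E (sgn (σ a * σ b)) :=
  div_mul_cancel₀ _ (wsum_one_pos σ ht E).ne'

theorem wsum_mul_wsum_sgn_le (ht : t ∈ Set.Icc (0 : ℝ) 1) (E : Finset (Sym2 V)) {F : Ω → ℝ}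
    (hF : F ∈ griffithsCone Ω) (ψ : Ω →* ℤˣ) :
    wsum σ t E F * wsum σ t E (sgn ψ) ≤ wsum σ t E (F * sgn ψ) * wsum σ t E 1 := by
  simpa only [wsum, Pi.mul_apply, Pi.one_apply, one_mul] using
    griffiths_second hF (weight_mul_translate_mem_griffithsCone σ ht E) ψ

theorem corr_mul_wsum_le (ht : t ∈ Set.Icc (0 : ℝ) 1) {D E : Finset (Sym2 V)}
    (h : D ⊆ E) (a b : V) {F : Ω → ℝ} (hF : F ∈ griffithsCone Ω) :
    corr σ t D a b * wsum σ t E F ≤ wsum σ t E (F * sgn (σ a * σ b)) := by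
  classical
  rw [corr, div_mul_eq_mul_div, div_le_iff₀ (wsum_one_pos σ ht D), mul_comm, ← wsum_sdiff σ h F,
    ← wsum_sdiff σ h (F * _), mul_right_comm]
  exact wsum_mul_wsum_sgn_le σ ht D (mul_mem hF (weight_mem_griffithsCone σ ht.1 _)) _

theorem corr_nonneg (ht : t ∈ Set.Icc (0 : ℝ) 1) (E : Finset (Sym2 V)) (a b : V) :
    0 ≤ corr σ t E a b :=
  div_nonneg (wsum_nonneg σ ht.1 E (sgn_mem_griffithsCone _)) (wsum_one_pos σ ht E).le

theorem corr_self (ht : t ∈ Set.Icc (0 : ℝ) 1) (E : Finset (Sym2 V)) (a : V) :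
    corr σ t E a a = 1 := by
  rw [corr, char_mul_self, sgn_one, div_self (wsum_one_pos σ ht E).ne']

theorem corr_le_one (ht : t ∈ Set.Icc (0 : ℝ) 1) (E : Finset (Sym2 V)) (a b : V) :
    corr σ t E a b ≤ 1 :=
  (div_le_one (wsum_one_pos σ ht E)).2 <| Finset.sum_le_sum fun ω _ =>
    mul_le_mul_of_nonneg_right (sgn_le_one _ _) (weight_nonneg σ ht E ω)

theorem corr_mono (ht : t ∈ Set.Icc (0 : ℝ) 1) {D E : Finset (Sym2 V)} (h : D ⊆ E) (a b : V) :
    corr σ t D a b ≤ corr σ t E a b := by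
  rw [corr.eq_def σ t E, le_div_iff₀ (wsum_one_pos σ ht E)]
  simpa only [one_mul] using corr_mul_wsum_le σ ht h a b (one_mem (griffithsCone Ω))

theorem corr_mul_corr_le (ht : t ∈ Set.Icc (0 : ℝ) 1) (E : Finset (Sym2 V)) (a b c : V) :
    corr σ t E a b * corr σ t E b c ≤ corr σ t E a c := by
  have h := corr_mul_wsum_le σ ht subset_rfl a b (E := E) (sgn_mem_griffithsCone (σ b * σ c))
  rw [← sgn_mul, mul_comm (σ b * σ c), char_mul_mul_mul_cancel] at h
  rw [corr.eq_def σ t E b c, corr.eq_def σ t E a c, ← mul_div_assoc]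
  exact div_le_div_of_nonneg_right h (wsum_one_pos σ ht E).le

variable [DecidableEq V]

theorem one_add_mul_wsum_erase_le (ht : t ∈ Set.Icc (0 : ℝ) 1) {D E : Finset (Sym2 V)} {a u : V}
    (he : s(a, u) ∈ E) (h : D ⊆ E.erase s(a, u)) {F : Ω → ℝ} (hF : F ∈ griffithsCone Ω) :
    (1 + t * corr σ t D a u) * wsum σ t (E.erase s(a, u)) F ≤ wsum σ t E F := by
  rw [wsum_eq_erase_add σ he]
  linarith [mul_le_mul_of_nonneg_left (corr_mul_wsum_le σ ht h a u hF) ht.1]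

theorem wsum_erase_le (ht0 : 0 ≤ t) {E : Finset (Sym2 V)} {a u : V} (he : s(a, u) ∈ E)
    {F : Ω → ℝ} (hF : F ∈ griffithsCone Ω) : wsum σ t (E.erase s(a, u)) F ≤ wsum σ t E F := by
  rw [wsum_eq_erase_add σ he]
  exact le_add_of_nonneg_right (mul_nonneg ht0
    (wsum_nonneg σ ht0 _ (mul_mem hF (sgn_mem_griffithsCone _))))

theorem one_add_mul_corr_eq (ht : t ∈ Set.Icc (0 : ℝ) 1) {E : Finset (Sym2 V)} {a u : V}
    (he : s(a, u) ∈ E) (b : V) :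
    (1 + t * corr σ t (E.erase s(a, u)) a u) * corr σ t E a b
      = corr σ t (E.erase s(a, u)) a b + t * corr σ t (E.erase s(a, u)) u b := by
  have hone := wsum_eq_erase_add σ (t := t) he 1
  have hab := wsum_eq_erase_add σ (t := t) he (sgn (σ a * σ b))
  rw [one_mul, ← corr_mul_wsum_one σ ht] at hone
  rw [← sgn_mul, mul_comm (σ a) (σ b), mul_comm (σ a) (σ u), mul_comm (σ b * σ a), mul_comm (σ b),
    char_mul_mul_mul_cancel, ← corr_mul_wsum_one σ ht, ← corr_mul_wsum_one σ ht,
    ← corr_mul_wsum_one σ ht, hone] at hab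
  refine mul_right_cancel₀ (wsum_one_pos σ ht (E.erase s(a, u))).ne' ?_
  linear_combination hab

theorem corr_erase_add_mul_wsum_erase_le (ht : t ∈ Set.Icc (0 : ℝ) 1) {D E : Finset (Sym2 V)}
    (hDE : D ⊆ E) {a u : V} (he : s(a, u) ∈ D) (b : V) {F : Ω → ℝ} (hF : F ∈ griffithsCone Ω) :
    (corr σ t (D.erase s(a, u)) a b + t * corr σ t (D.erase s(a, u)) u b)
        * wsum σ t (E.erase s(a, u)) F ≤ corr σ t D a b * wsum σ t E F := by
  rw [← one_add_mul_corr_eq σ ht he, mul_right_comm, mul_comm (corr σ t D a b)]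
  exact mul_le_mul_of_nonneg_right
    (one_add_mul_wsum_erase_le σ ht (hDE he) (Finset.erase_subset_erase _ hDE) hF)
    (corr_nonneg σ ht D a b)

end Correlations

section Simon

variable {Ω : Type*} [CommGroup Ω] [Fintype Ω] {V : Type*} (σ : V → Ω →* ℤˣ) {t : ℝ}

open Classical in
/-- The edges of `E` with both end points in `U`, that is, the system restricted to `U`. -/
def inside (E : Finset (Sym2 V)) (U : Set V) : Finset (Sym2 V) := E.filter fun e => ∀ v ∈ e, v ∈ U

theorem mem_inside {E : Finset (Sym2 V)} {U : Set V} {e : Sym2 V} :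
    e ∈ inside E U ↔ e ∈ E ∧ ∀ v ∈ e, v ∈ U := by
  classical exact Finset.mem_filter

theorem inside_subset (E : Finset (Sym2 V)) (U : Set V) : inside E U ⊆ E := by
  classical exact Finset.filter_subset _ _

open Classical in
/-- The edges of `E` with an end point in `U`. -/
def touching (E : Finset (Sym2 V)) (U : Set V) : Finset (Sym2 V) := E.filter fun e => ∃ v ∈ e, v ∈ U

theorem mem_touching {E : Finset (Sym2 V)} {U : Set V} {e : Sym2 V} :
    e ∈ touching E U ↔ e ∈ E ∧ ∃ v ∈ e, v ∈ U := by
  classical exact Finset.mem_filter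

theorem touching_subset (E : Finset (Sym2 V)) (U : Set V) : touching E U ⊆ E := by
  classical exact Finset.filter_subset _ _

theorem inside_touching (E : Finset (Sym2 V)) (U : Set V) :
    inside (touching E U) U = inside E U := by
  ext e
  simp only [mem_inside, mem_touching, and_assoc, and_congr_right_iff, and_iff_right_iff_imp]
  exact fun _ h => ⟨_, Sym2.out_fst_mem e, h _ (Sym2.out_fst_mem e)⟩

theorem inside_erase [DecidableEq V] (E : Finset (Sym2 V)) (U : Set V) (e : Sym2 V) :
    inside (E.erase e) U = (inside E U).erase e := by
  ext; simp [mem_inside, and_assoc]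

theorem le_sum_corr_mul (ht : t ∈ Set.Icc (0 : ℝ) 1) (E : Finset (Sym2 V)) {Y : Finset V}
    {G : V → ℝ} (hG : ∀ y ∈ Y, 0 ≤ G y) {u : V} (hu : u ∈ Y) :
    G u ≤ ∑ y ∈ Y, corr σ t E u y * G y := by
  simpa only [corr_self σ ht, one_mul] using
    Finset.single_le_sum (f := fun y => corr σ t E u y * G y)
      (fun y hy => mul_nonneg (corr_nonneg σ ht E u y) (hG y hy)) hu

theorem wsum_mul_sgn_eq_zero {E : Finset (Sym2 V)} {w : Ω → ℝ} {a b : V} {g : Ω}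
    (hg : IsFlip σ a g) (hw : ∀ ω, w (g * ω) = w ω) (hE : ∀ e ∈ E, a ∉ e) (hab : b ≠ a) :
    wsum σ t E (w * sgn (σ a * σ b)) = 0 := by
  have hsum := sum_sgn_mul_eq_zero (hg.mul_apply_eq_neg_one hab) (F := w * weight σ t E) fun ω => by
    rw [Pi.mul_apply, Pi.mul_apply, hw, hg.weight_mul hE]
  simpa only [wsum, Pi.mul_apply, mul_assoc, mul_left_comm] using hsum

theorem wsum_mul_sgn_le_of_notMem (ht : t ∈ Set.Icc (0 : ℝ) 1) {E : Finset (Sym2 V)} {w : Ω → ℝ}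
    {a : V} {g : Ω} (hg : IsFlip σ a g) (hw : w ∈ griffithsCone Ω) (hwg : ∀ ω, w (g * ω) = w ω)
    (hE : ∀ e ∈ E, a ∉ e) (D : Finset (Sym2 V)) (b : V) :
    wsum σ t E (w * sgn (σ a * σ b)) ≤ corr σ t D a b * wsum σ t E w := by
  rcases eq_or_ne b a with rfl | hab
  · rw [corr_self σ ht, one_mul, char_mul_self, sgn_one, mul_one]
  · rw [wsum_mul_sgn_eq_zero σ hg hwg hE hab]
    exact mul_nonneg (corr_nonneg σ ht D a b) (wsum_nonneg σ ht.1 E hw)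

theorem corr_eq_zero {E : Finset (Sym2 V)} {a b : V} {g : Ω} (hg : IsFlip σ a g)
    (hE : ∀ e ∈ E, a ∉ e) (hab : b ≠ a) : corr σ t E a b = 0 := by
  rw [corr, ← one_mul (sgn (σ a * σ b)),
    wsum_mul_sgn_eq_zero σ hg (w := 1) (fun _ => rfl) hE hab, zero_div]

theorem wsum_mul_sgn_eq_erase_add [DecidableEq V] {E : Finset (Sym2 V)} {a u : V}
    (he : s(a, u) ∈ E) (b : V) (w : Ω → ℝ) :
    wsum σ t E (w * sgn (σ a * σ b)) = wsum σ t (E.erase s(a, u)) (w * sgn (σ a * σ b))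
      + t * wsum σ t (E.erase s(a, u)) (w * sgn (σ u * σ b)) := by
  rw [wsum_eq_erase_add σ he, mul_assoc, ← sgn_mul, mul_comm (σ a * σ b), mul_comm (σ a) (σ u),
    char_mul_mul_mul_cancel]

theorem sum_corr_erase_add_le [DecidableEq V] (ht : t ∈ Set.Icc (0 : ℝ) 1) {E : Finset (Sym2 V)}
    {a u : V} (he : s(a, u) ∈ E) (Y : Finset V) {F : V → Ω → ℝ}
    (hF : ∀ y ∈ Y, F y ∈ griffithsCone Ω) :
    ∑ y ∈ Y, corr σ t (E.erase s(a, u)) a y * wsum σ t (E.erase s(a, u)) (F y)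
        + t * ∑ y ∈ Y, corr σ t (E.erase s(a, u)) u y * wsum σ t (E.erase s(a, u)) (F y)
      ≤ ∑ y ∈ Y, corr σ t E a y * wsum σ t E (F y) := by
  rw [Finset.mul_sum, ← Finset.sum_add_distrib]
  refine Finset.sum_le_sum fun y hy => ?_
  rw [← mul_assoc, ← add_mul]
  exact corr_erase_add_mul_wsum_erase_le σ ht subset_rfl he y (hF y hy)

/-- A Simon-type inequality, by removing the edges at `a` one by one. -/
theorem wsum_mul_sgn_le_add_sum (ht : t ∈ Set.Icc (0 : ℝ) 1) {U : Set V} {Y : Finset V}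
    {w : Ω → ℝ} (hw : w ∈ griffithsCone Ω)
    (hflip : ∀ u ∈ U, ∃ g, IsFlip σ u g ∧ ∀ ω, w (g * ω) = w ω) (b : V)
    {E : Finset (Sym2 V)} (hE : ∀ e ∈ E, ∀ v ∈ e, v ∈ U ∨ v ∈ Y) {a : V} (ha : a ∈ U) :
    wsum σ t E (w * sgn (σ a * σ b)) ≤ corr σ t (inside E U) a b * wsum σ t E w
      + ∑ y ∈ Y, corr σ t E a y * wsum σ t E (w * sgn (σ y * σ b)) := by
  classical
  have hcone (y : V) : w * sgn (σ y * σ b) ∈ griffithsCone Ω := mul_mem hw (sgn_mem_griffithsCone _)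
  induction hn : E.card using Nat.strong_induction_on generalizing E a with
  | _ n ih =>
  by_cases hedge : ∃ u, s(a, u) ∈ E
  · obtain ⟨u, hu⟩ := hedge
    have ih_erase {c : V} (hc : c ∈ U) := ih (E.erase s(a, u)).card
      (hn ▸ Finset.card_erase_lt_of_mem hu) (fun e he => hE e (Finset.mem_of_mem_erase he)) hc rfl
    have hinside := inside_erase E U s(a, u)
    have iha := ih_erase ha
    have hY := sum_corr_erase_add_le σ ht hu Y fun y _ => hcone y
    rw [wsum_mul_sgn_eq_erase_add σ hu]
    by_cases huU : u ∈ U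
    · have hmem : s(a, u) ∈ inside E U := by simp [mem_inside, hu, ha, huU]
      have hU := corr_erase_add_mul_wsum_erase_le σ ht (inside_subset E U) hmem b hw
      rw [← hinside, add_mul, mul_assoc] at hU
      linarith [iha, mul_le_mul_of_nonneg_left (ih_erase huU) ht.1]
    · have huY : u ∈ Y := (hE _ hu u (Sym2.mem_mk_right a u)).resolve_left huU
      have hmem : s(a, u) ∉ inside E U := by simp [mem_inside, huU]
      rw [Finset.erase_eq_of_notMem hmem] at hinside
      have hU := mul_le_mul_of_nonneg_left (wsum_erase_le σ ht.1 hu hw)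
        (corr_nonneg σ ht (inside E U) a b)
      have hu_le := mul_le_mul_of_nonneg_left (le_sum_corr_mul σ ht (E.erase s(a, u))
        (fun y _ => wsum_nonneg σ ht.1 (E.erase s(a, u)) (hcone y)) huY) ht.1
      rw [hinside] at iha
      linarith
  · obtain ⟨g, hg, hwg⟩ := hflip a ha
    exact le_add_of_le_of_nonneg
      (wsum_mul_sgn_le_of_notMem σ ht hg hw hwg (fun e he ⟨u, hu⟩ => hedge ⟨u, hu ▸ he⟩) _ b)
      (Finset.sum_nonneg fun y _ =>
        mul_nonneg (corr_nonneg σ ht E a y) (wsum_nonneg σ ht.1 E (hcone y)))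

theorem wsum_mul_sgn_le_of_separating (ht : t ∈ Set.Icc (0 : ℝ) 1) {U : Set V} {Y : Finset V}
    {w : Ω → ℝ} (hw : w ∈ griffithsCone Ω)
    (hflip : ∀ u ∈ U, ∃ g, IsFlip σ u g ∧ ∀ ω, w (g * ω) = w ω) (b : V)
    {E : Finset (Sym2 V)} (hE : ∀ e ∈ touching E U, ∀ v ∈ e, v ∈ U ∨ v ∈ Y) {a : V} (ha : a ∈ U) :
    wsum σ t E (w * sgn (σ a * σ b)) ≤ corr σ t (inside E U) a b * wsum σ t E w
      + ∑ y ∈ Y, corr σ t (touching E U) a y * wsum σ t E (w * sgn (σ y * σ b)) := by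
  classical
  have h := wsum_mul_sgn_le_add_sum σ ht (w := w * weight σ t (E \ touching E U))
    (mul_mem hw (weight_mem_griffithsCone σ ht.1 _)) (fun u hu => ?_) b hE ha
  · simpa only [mul_right_comm w, wsum_sdiff σ (touching_subset E U), inside_touching] using h
  · obtain ⟨g, hg, hwg⟩ := hflip u hu
    refine ⟨g, hg, fun ω => ?_⟩
    rw [Pi.mul_apply, Pi.mul_apply, hwg, hg.weight_mul fun e he hue => ?_]
    rw [Finset.mem_sdiff, mem_touching] at he
    exact he.2 ⟨he.1, u, hue, hu⟩

/-- Simon's inequality for the set `Y` separating `U` from the rest of the graph. -/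
theorem corr_le_of_separating (ht : t ∈ Set.Icc (0 : ℝ) 1) (hflip : ∀ u, ∃ g, IsFlip σ u g)
    {E : Finset (Sym2 V)} {U : Set V} {Y : Finset V}
    (hE : ∀ e ∈ touching E U, ∀ v ∈ e, v ∈ U ∨ v ∈ Y) {a : V} (ha : a ∈ U) (b : V) :
    corr σ t E a b ≤ corr σ t (inside E U) a b
      + ∑ y ∈ Y, corr σ t (touching E U) a y * corr σ t E y b := by
  have h := wsum_mul_sgn_le_of_separating σ ht (one_mem (griffithsCone Ω))
    (fun u _ => (hflip u).imp fun g hg => ⟨hg, fun _ => rfl⟩) b hE ha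
  simp only [one_mul, ← corr_mul_wsum_one σ ht E] at h
  simp only [← mul_assoc, ← Finset.sum_mul, ← add_mul] at h
  exact le_of_mul_le_mul_right h (wsum_one_pos σ ht E)

theorem corr_le_corr_inside_add (ht : t ∈ Set.Icc (0 : ℝ) 1) (hflip : ∀ u, ∃ g, IsFlip σ u g)
    (E : Finset (Sym2 V)) {Y : Finset V} {a : V} (ha : a ∉ Y) (b : V) :
    corr σ t E a b ≤ corr σ t (inside E {v | v ∉ Y}) a b
      + ∑ y ∈ Y, corr σ t E a y * corr σ t E y b :=
  (corr_le_of_separating σ ht hflip (fun _ _ v _ => (em (v ∈ Y)).symm) ha b).trans <|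
    add_le_add_right (Finset.sum_le_sum fun y _ => mul_le_mul_of_nonneg_right
      (corr_mono σ ht (touching_subset E _) a y) (corr_nonneg σ ht E y b)) _

end Simon

/-! ### Joint exploration of a finite graph and of a covering graph -/

section Exploration

variable {Ω X Z : Type*}

/-- `p` is a covering map from the graph with edge set `EZ` to the graph with edge set `EX`. -/
structure IsCover (p : Z → X) (EX : Finset (Sym2 X)) (EZ : Finset (Sym2 Z)) : Prop where
  map_mem : ∀ e ∈ EZ, e.map p ∈ EX
  inj : ∀ k w w', s(k, w) ∈ EZ → s(k, w') ∈ EZ → p w = p w' → w = w'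
  lift : ∀ k b, s(p k, b) ∈ EX → ∃ w, p w = b ∧ s(k, w) ∈ EZ

variable (Ω X Z) in
/-- A stage of the exploration of a covering graph with vertices `Z` together with its base, with
vertices `X`: the explored vertices of the covering, the factor of the weight revealed so far, and
the unrevealed edges of the base and of the covering. -/
structure Stage where
  explored : Finset Z
  factor : Ω → ℝ
  baseEdges : Finset (Sym2 X)
  coverEdges : Finset (Sym2 Z)

namespace Stage

/-- No unrevealed edge at an explored vertex lies above an unrevealed edge of the base. -/
def Terminal (p : Z → X) (S : Stage Ω X Z) : Prop :=
  ∀ e ∈ S.coverEdges, ∀ k ∈ S.explored, k ∈ e → e.map p ∉ S.baseEdges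

open Classical in
/-- The vertices whose fibre contains another vertex that has been explored. -/
def doubled [Fintype Z] (p : Z → X) (S : Stage Ω X Z) : Finset Z :=
  {y | ∃ k ∈ S.explored, p k = p y ∧ k ≠ y}

theorem mem_doubled [Fintype Z] {p : Z → X} {S : Stage Ω X Z} {y : Z} :
    y ∈ S.doubled p ↔ ∃ k ∈ S.explored, p k = p y ∧ k ≠ y := by
  classical exact Finset.mem_filter_univ y

/-- The vertices that the root is correlated with only through the doubled vertices. -/
def screened [Fintype Z] (p : Z → X) (S : Stage Ω X Z) : Set Z :=
  {v | v ∉ S.explored ∧ v ∉ S.doubled p}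

/-- The exploration from `o` before any edge has been revealed. -/
def initial (EX : Finset (Sym2 X)) (EZ : Finset (Sym2 Z)) (o : Z) : Stage Ω X Z := ⟨{o}, 1, EX, EZ⟩

variable [CommGroup Ω]

/-- The weight of the configurations of the two systems, with spins `s` and `σ`, at a stage of the
exploration. -/
def jointWeight (s : X → Ω →* ℤˣ) (σ : Z → Ω →* ℤˣ) (t : ℝ) (S : Stage Ω X Z) : Ω → ℝ :=
  S.factor * (weight s t S.baseEdges * weight σ t S.coverEdges)

/-- The invariants of the exploration from the vertex `o`. -/
structure Valid (s : X → Ω →* ℤˣ) (σ : Z → Ω →* ℤˣ) (p : Z → X) (EX : Finset (Sym2 X))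
    (EZ : Finset (Sym2 Z)) (o : Z) (S : Stage Ω X Z) : Prop where
  factor_mem : S.factor ∈ griffithsCone Ω
  root_mem : o ∈ S.explored
  agree : ∀ k ∈ S.explored, S.factor * sgn (s (p k) * σ k) = S.factor * sgn (s (p o) * σ o)
  factor_mul : ∀ g, (∀ k ∈ S.explored, s (p k) g = 1 ∧ σ k g = 1) →
    ∀ ω, S.factor (g * ω) = S.factor ω
  baseEdges_subset : S.baseEdges ⊆ EX
  coverEdges_subset : S.coverEdges ⊆ EZ
  touch : ∀ e ∈ EZ, e ∉ S.coverEdges → ∃ k ∈ S.explored, k ∈ e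
  map_notMem : ∀ e ∈ EZ, e ∉ S.coverEdges → e.map p ∉ S.baseEdges
  exists_of_map_notMem : ∀ e ∈ S.coverEdges, e.map p ∉ S.baseEdges →
    ∃ e' ∈ EZ, e' ∉ S.coverEdges ∧ e'.map p = e.map p

variable {s : X → Ω →* ℤˣ} {σ : Z → Ω →* ℤˣ} {p : Z → X} {EX : Finset (Sym2 X)}
  {EZ : Finset (Sym2 Z)} {o : Z} {S : Stage Ω X Z} {t : ℝ}

theorem valid_initial (hp : IsCover p EX EZ) (o : Z) :
    (initial EX EZ o : Stage Ω X Z).Valid s σ p EX EZ o where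
  factor_mem := one_mem _
  root_mem := Finset.mem_singleton_self o
  agree k hk := by rw [Finset.mem_singleton.1 hk]
  factor_mul _ _ _ := rfl
  baseEdges_subset := subset_rfl
  coverEdges_subset := subset_rfl
  touch _ he hn := absurd he hn
  map_notMem _ he hn := absurd he hn
  exists_of_map_notMem e he hn := absurd (hp.map_mem e he) hn

namespace Valid

theorem mul_sgn_eq_of_agree (hS : S.Valid s σ p EX EZ o) {k : Z} (hk : k ∈ S.explored)
    (χ : Ω →* ℤˣ) :
    S.factor * sgn (s (p k) * σ k * χ) = S.factor * sgn (s (p o) * σ o * χ) := by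
  rw [sgn_mul, sgn_mul _ χ, ← mul_assoc, hS.agree k hk, mul_assoc]

theorem notMem_of_terminal (hp : IsCover p EX EZ) (hS : S.Valid s σ p EX EZ o)
    (hT : S.Terminal p) {k : Z} (hk : k ∈ S.explored) : ∀ e ∈ S.baseEdges, p k ∉ e := by
  rintro _ he ⟨b, rfl⟩
  obtain ⟨w, rfl, hw⟩ := hp.lift k b (hS.baseEdges_subset he)
  by_cases h : s(k, w) ∈ S.coverEdges
  · exact hT _ h k hk (Sym2.mem_mk_left k w) he
  · exact hS.map_notMem _ hw h he

theorem mem_doubled_of_terminal [Fintype Z] (hp : IsCover p EX EZ)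
    (hS : S.Valid s σ p EX EZ o) (hT : S.Terminal p) {k w : Z} (hk : k ∈ S.explored)
    (he : s(k, w) ∈ S.coverEdges) : k ∈ S.doubled p ∨ w ∈ S.doubled p := by
  obtain ⟨_, he', hn', hmap⟩ :=
    hS.exists_of_map_notMem _ he (hT _ he k hk (Sym2.mem_mk_left k w))
  obtain ⟨l, hl, v, rfl⟩ := hS.touch _ he' hn'
  have hne : s(l, v) ≠ s(k, w) := fun h => hn' (h ▸ he)
  have he_swap : s(w, k) ∈ EZ := Sym2.eq_swap ▸ hS.coverEdges_subset he
  simp only [mem_doubled]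
  rw [Sym2.map_mk, Sym2.map_mk, Sym2.eq_iff] at hmap
  rcases hmap with ⟨hlk, hvw⟩ | ⟨hlw, hvk⟩
  · refine Or.inl ⟨l, hl, hlk, ?_⟩
    rintro rfl
    exact hne (by rw [hp.inj l v w he' (hS.coverEdges_subset he) hvw])
  · refine Or.inr ⟨l, hl, hlw, ?_⟩
    rintro rfl
    exact hne (by rw [hp.inj l v k he' he_swap hvk, Sym2.eq_swap])

theorem mem_screened_or_mem_doubled [Fintype Z] (hp : IsCover p EX EZ)
    (hS : S.Valid s σ p EX EZ o) (hT : S.Terminal p) :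
    ∀ e ∈ touching S.coverEdges (S.screened p), ∀ v ∈ e, v ∈ S.screened p ∨ v ∈ S.doubled p := by
  rintro _ he v ⟨u, rfl⟩
  obtain ⟨he, c, hc, hcU⟩ := mem_touching.1 he
  rcases Sym2.mem_iff.1 hc with rfl | rfl
  · exact Or.inl hcU
  · refine or_iff_not_imp_right.2 fun hv => ⟨fun hvK => ?_, hv⟩
    exact (hS.mem_doubled_of_terminal hp hT hvK he).elim hv hcU.2

end Valid

variable [DecidableEq X] [DecidableEq Z]

/-- The edge from `k` to `w` and its projection are revealed, and found closed. Together with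
`openEdge` this is the expansion
`(1 + tA) (1 + tB) = (1 - t²) + t (1 + AB) (t + A)` for `A, B ∈ {1, -1}`. -/
def closeEdge (p : Z → X) (t : ℝ) (S : Stage Ω X Z) (k w : Z) : Stage Ω X Z where
  explored := S.explored
  factor := (1 - t ^ 2) • S.factor
  baseEdges := S.baseEdges.erase s(p k, p w)
  coverEdges := S.coverEdges.erase s(k, w)

/-- The edge from `k` to `w` and its projection are revealed, and found open, so that the products
of the two spins agree along them. -/
def openEdge (s : X → Ω →* ℤˣ) (σ : Z → Ω →* ℤˣ) (p : Z → X) (t : ℝ) (S : Stage Ω X Z) (k w : Z) :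
    Stage Ω X Z where
  explored := insert w S.explored
  factor := S.factor * ((t • fun ω => t + 1 * sgn (s (p k) * s (p w)) ω) *
    (1 + sgn (s (p k) * s (p w) * (σ k * σ w))))
  baseEdges := S.baseEdges.erase s(p k, p w)
  coverEdges := S.coverEdges.erase s(k, w)

theorem jointWeight_eq_closeEdge_add_openEdge {k w : Z} (hX : s(p k, p w) ∈ S.baseEdges)
    (hZ : s(k, w) ∈ S.coverEdges) :
    S.jointWeight s σ t = (S.closeEdge p t k w).jointWeight s σ t
      + (S.openEdge s σ p t k w).jointWeight s σ t := by
  ext ω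
  have hsq := congrFun (sgn_mul_self (s (p k) * s (p w))) ω
  simp only [jointWeight, closeEdge, openEdge, weight_eq_mul_erase s t hX,
    weight_eq_mul_erase σ t hZ, sgn_mul _ (σ k * σ w), Pi.mul_apply, Pi.add_apply, Pi.one_apply,
    Pi.smul_apply, smul_eq_mul] at hsq ⊢
  linear_combination (-S.factor ω * weight s t (S.baseEdges.erase s(p k, p w)) ω
    * weight σ t (S.coverEdges.erase s(k, w)) ω * t * sgn (σ k * σ w) ω) * hsq

namespace Valid

theorem closeEdge (ht : t ∈ Set.Icc (0 : ℝ) 1) (hS : S.Valid s σ p EX EZ o) {k w : Z}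
    (hk : k ∈ S.explored) (he : s(k, w) ∈ S.coverEdges) :
    (S.closeEdge p t k w).Valid s σ p EX EZ o where
  factor_mem := smul_mem_griffithsCone (by nlinarith [ht.1, ht.2]) hS.factor_mem
  root_mem := hS.root_mem
  agree l hl := by simp only [Stage.closeEdge, smul_mul_assoc, hS.agree l hl]
  factor_mul g hg ω := by
    simp only [Stage.closeEdge, Pi.smul_apply, hS.factor_mul g hg ω]
  baseEdges_subset := (Finset.erase_subset _ _).trans hS.baseEdges_subset
  coverEdges_subset := (Finset.erase_subset _ _).trans hS.coverEdges_subset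
  touch e he' hn := by
    by_cases h : e = s(k, w)
    · exact ⟨k, hk, h ▸ Sym2.mem_mk_left k w⟩
    · exact hS.touch e he' fun h' => hn (Finset.mem_erase.2 ⟨h, h'⟩)
  map_notMem e he' hn := by
    by_cases h : e = s(k, w)
    · exact h ▸ Finset.notMem_erase _ _
    · exact fun hm => hS.map_notMem e he' (fun h' => hn (Finset.mem_erase.2 ⟨h, h'⟩))
        (Finset.mem_of_mem_erase hm)
  exists_of_map_notMem e he' hn := by
    by_cases h : e.map p = s(p k, p w)
    · exact ⟨s(k, w), hS.coverEdges_subset he, Finset.notMem_erase _ _, h.symm⟩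
    · obtain ⟨e₁, h₁, hn₁, hmap⟩ := hS.exists_of_map_notMem e (Finset.mem_of_mem_erase he')
        fun h' => hn (Finset.mem_erase.2 ⟨h, h'⟩)
      exact ⟨e₁, h₁, fun h' => hn₁ (Finset.mem_of_mem_erase h'), hmap⟩

theorem openEdge_agree (hS : S.Valid s σ p EX EZ o) {k w l : Z} (hk : k ∈ S.explored)
    (hl : l ∈ insert w S.explored) :
    (S.openEdge s σ p t k w).factor * sgn (s (p l) * σ l)
      = (S.openEdge s σ p t k w).factor * sgn (s (p o) * σ o) := by
  simp only [openEdge]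
  rcases Finset.mem_insert.1 hl with rfl | hl
  · have hχ : s (p l) * σ l = s (p k) * s (p l) * (σ k * σ l) * (s (p k) * σ k) := by
      rw [mul_mul_mul_comm (s (p k)), mul_right_comm, char_mul_self, one_mul]
    have hstep : (1 + sgn (s (p k) * s (p l) * (σ k * σ l))) * sgn (s (p l) * σ l)
        = (1 + sgn (s (p k) * s (p l) * (σ k * σ l))) * sgn (s (p k) * σ k) := by
      rw [hχ, sgn_mul _ (s (p k) * σ k), ← mul_assoc, one_add_sgn_mul_self]
    rw [mul_assoc, mul_assoc, hstep, ← mul_assoc (t • _), mul_left_comm, hS.agree k hk,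
      mul_left_comm, ← mul_assoc]
  · rw [mul_right_comm, hS.agree l hl, mul_right_comm]

theorem openEdge (ht : t ∈ Set.Icc (0 : ℝ) 1) (hS : S.Valid s σ p EX EZ o) {k w : Z}
    (hk : k ∈ S.explored) (he : s(k, w) ∈ S.coverEdges) :
    (S.openEdge s σ p t k w).Valid s σ p EX EZ o := by
  have hclose := hS.closeEdge ht hk he
  refine ⟨?_, Finset.mem_insert_of_mem hS.root_mem, fun l hl => hS.openEdge_agree hk hl, ?_,
    hclose.baseEdges_subset, hclose.coverEdges_subset, ?_, hclose.map_notMem,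
    hclose.exists_of_map_notMem⟩
  · exact mul_mem hS.factor_mem (mul_mem
      (smul_mem_griffithsCone ht.1 (affine_mem_griffithsCone ht.1 zero_le_one _))
      (add_mem (one_mem _) (sgn_mem_griffithsCone _)))
  · intro g hg ω
    obtain ⟨hsk, hσk⟩ := hg k (Finset.mem_insert_of_mem hk)
    obtain ⟨hsw, hσw⟩ := hg w (Finset.mem_insert_self w S.explored)
    have hbase : sgn (s (p k) * s (p w)) g = 1 := by simp [sgn, hsk, hsw]
    have hjoint : sgn (s (p k) * s (p w) * (σ k * σ w)) g = 1 := by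
      simp [sgn, hsk, hsw, hσk, hσw]
    simp only [Stage.openEdge, Pi.mul_apply, Pi.smul_apply, Pi.add_apply, Pi.one_apply,
      hS.factor_mul g (fun l hl => hg l (Finset.mem_insert_of_mem hl)) ω, sgn_apply_mul _ g ω,
      hbase, hjoint, one_mul]
  · intro e he' hn
    obtain ⟨l, hl, hle⟩ := hclose.touch e he' hn
    exact ⟨l, Finset.mem_insert_of_mem hl, hle⟩

end Valid

end Stage

/-- The weight at the stage `S` is the sum of the weights at the terminal stages `l i`. -/
structure IsTerminalDecomposition {ι : Type} [Fintype ι] [CommGroup Ω] (s : X → Ω →* ℤˣ)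
    (σ : Z → Ω →* ℤˣ) (p : Z → X) (t : ℝ) (EX : Finset (Sym2 X)) (EZ : Finset (Sym2 Z)) (o : Z)
    (S : Stage Ω X Z) (l : ι → Stage Ω X Z) : Prop where
  valid : ∀ i, (l i).Valid s σ p EX EZ o
  terminal : ∀ i, (l i).Terminal p
  jointWeight_eq : S.jointWeight s σ t = ∑ i, (l i).jointWeight s σ t

theorem Stage.Valid.exists_isTerminalDecomposition [CommGroup Ω] {s : X → Ω →* ℤˣ}
    {σ : Z → Ω →* ℤˣ} {p : Z → X} {EX : Finset (Sym2 X)} {EZ : Finset (Sym2 Z)} {o : Z} {t : ℝ}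
    (ht : t ∈ Set.Icc (0 : ℝ) 1) {S : Stage Ω X Z} (hS : S.Valid s σ p EX EZ o) :
    ∃ (ι : Type) (_ : Fintype ι) (l : ι → Stage Ω X Z),
      IsTerminalDecomposition s σ p t EX EZ o S l := by
  classical
  induction hn : S.baseEdges.card using Nat.strong_induction_on generalizing S with
  | _ n ih =>
  subst hn
  by_cases hT : S.Terminal p
  · exact ⟨Unit, inferInstance, fun _ => S, fun _ => hS, fun _ => hT, by simp⟩
  · simp only [Stage.Terminal, not_forall, not_not] at hT
    obtain ⟨_, he, k, hk, ⟨w, rfl⟩, hm⟩ := hT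
    rw [Sym2.map_mk] at hm
    have hlt := Finset.card_erase_lt_of_mem hm
    obtain ⟨ι₁, _, l₁, h₁⟩ := ih _ hlt (hS.closeEdge ht hk he) rfl
    obtain ⟨ι₂, _, l₂, h₂⟩ := ih _ hlt (hS.openEdge ht hk he) rfl
    refine ⟨ι₁ ⊕ ι₂, inferInstance, Sum.elim l₁ l₂, Sum.rec h₁.valid h₂.valid,
      Sum.rec h₁.terminal h₂.terminal, ?_⟩
    rw [Stage.jointWeight_eq_closeEdge_add_openEdge hm he, h₁.jointWeight_eq, h₂.jointWeight_eq,
      Fintype.sum_sum_type]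
    rfl

end Exploration

/-! ### Correlations on a finite graph and on a covering graph -/

section Covering

variable {X Z : Type*}

/-- The spin at a vertex, as a character of the group of configurations. -/
def spin (x : X) : (X → ℤˣ) →* ℤˣ := Pi.evalMonoidHom (fun _ => ℤˣ) x

/-- The pairs of configurations of two systems with vertices `X` and `Z`. -/
abbrev PairConfig (X Z : Type*) := (X → ℤˣ) × (Z → ℤˣ)

variable (Z) in
/-- The spin at a vertex of the first of two systems. -/
def spinL (x : X) : PairConfig X Z →* ℤˣ := (spin x).comp (MonoidHom.fst _ _)

variable (X) in
/-- The spin at a vertex of the second of two systems. -/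
def spinR (z : Z) : PairConfig X Z →* ℤˣ := (spin z).comp (MonoidHom.snd _ _)

open Classical in
/-- The configuration which is `-1` on `A` and `1` elsewhere. -/
def flip (A : Set X) : X → ℤˣ := fun x => if x ∈ A then -1 else 1

theorem spin_flip_of_mem {A : Set X} {x : X} (h : x ∈ A) : spin x (flip A) = -1 := if_pos h

theorem spin_flip_of_notMem {A : Set X} {x : X} (h : x ∉ A) : spin x (flip A) = 1 := if_neg h

theorem isFlip_spin (u : X) : IsFlip spin u (flip {u}) :=
  ⟨spin_flip_of_mem rfl, fun _ hv => spin_flip_of_notMem hv⟩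

theorem isFlip_spinR (u : Z) : IsFlip (spinR X) u (1, flip {u}) := isFlip_spin u

theorem sgn_edgeChar_spinL (e : Sym2 X) (ω : PairConfig X Z) :
    sgn (edgeChar (spinL Z) e) ω = sgn (edgeChar spin e) ω.1 := by
  induction e with
  | _ x y => rfl

theorem sgn_edgeChar_spinR (e : Sym2 Z) (ω : PairConfig X Z) :
    sgn (edgeChar (spinR X) e) ω = sgn (edgeChar spin e) ω.2 := by
  induction e with
  | _ x y => rfl

variable {t : ℝ}

theorem weight_spinL (E : Finset (Sym2 X)) (ω : PairConfig X Z) :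
    weight (spinL Z) t E ω = weight spin t E ω.1 := by
  simp only [weight, sgn_edgeChar_spinL]

theorem weight_spinR (E : Finset (Sym2 Z)) (ω : PairConfig X Z) :
    weight (spinR X) t E ω = weight spin t E ω.2 := by
  simp only [weight, sgn_edgeChar_spinR]

theorem Stage.Valid.exists_isFlip_spinR {p : Z → X} {EX : Finset (Sym2 X)} {EZ : Finset (Sym2 Z)}
    {o u : Z} {S : Stage (PairConfig X Z) X Z} (hS : S.Valid (spinL Z) (spinR X) p EX EZ o)
    (hu : u ∉ S.explored) :
    ∃ g, IsFlip (spinR X) u g ∧ ∀ ω, (S.factor * weight (spinL Z) t S.baseEdges) (g * ω)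
      = (S.factor * weight (spinL Z) t S.baseEdges) ω := by
  refine ⟨(1, flip {u}), isFlip_spinR u, fun ω => ?_⟩
  rw [Pi.mul_apply, Pi.mul_apply,
    hS.factor_mul _ fun k hk => ⟨rfl, (isFlip_spinR u).2 k fun h => hu (h ▸ hk)⟩,
    weight_mul_of_edgeChar_eq_one _ fun e _ => edgeChar_eq_one _ fun v _ => rfl]

variable [Fintype X] [Fintype Z]

theorem wsum_spinR [DecidableEq X] [DecidableEq Z] (E : Finset (Sym2 Z)) (G : (Z → ℤˣ) → ℝ) :
    wsum (spinR X) t E (fun ω => G ω.2) = Fintype.card (X → ℤˣ) * wsum spin t E G := by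
  simp only [wsum, weight_spinR, Fintype.sum_prod_type, Finset.sum_const, Finset.card_univ,
    nsmul_eq_mul]

theorem corr_spinR [DecidableEq X] [DecidableEq Z] (E : Finset (Sym2 Z)) (a b : Z) :
    corr (spinR X) t E a b = corr spin t E a b := by
  rw [corr, corr, ← mul_div_mul_left (wsum spin t E _) (wsum spin t E 1)
    (Nat.cast_ne_zero.2 (Fintype.card_ne_zero (α := X → ℤˣ))), ← wsum_spinR, ← wsum_spinR]
  rfl

theorem sum_mul_weight_spinL_mul_weight_spinR [DecidableEq X] [DecidableEq Z]
    (EX : Finset (Sym2 X)) (EZ : Finset (Sym2 Z)) (F : (X → ℤˣ) → ℝ) (G : (Z → ℤˣ) → ℝ) :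
    ∑ ω : PairConfig X Z, F ω.1 * G ω.2 * (weight (spinL Z) t EX ω * weight (spinR X) t EZ ω)
      = wsum spin t EX F * wsum spin t EZ G := by
  simp only [wsum, weight_spinL, weight_spinR, Fintype.sum_prod_type, Finset.sum_mul_sum,
    mul_mul_mul_comm]

namespace Stage

variable [DecidableEq X] [DecidableEq Z]

/-- The unnormalised expectation of a character at a stage of the exploration. -/
def charSum (t : ℝ) (S : Stage (PairConfig X Z) X Z) (χ : PairConfig X Z →* ℤˣ) : ℝ :=
  ∑ ω, sgn χ ω * S.jointWeight (spinL Z) (spinR X) t ω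

variable {p : Z → X} {EX : Finset (Sym2 X)} {EZ : Finset (Sym2 Z)} {o : Z}
  {S : Stage (PairConfig X Z) X Z}

theorem charSum_eq_wsum (S : Stage (PairConfig X Z) X Z) (χ : PairConfig X Z →* ℤˣ) :
    S.charSum t χ
      = wsum (spinR X) t S.coverEdges (S.factor * weight (spinL Z) t S.baseEdges * sgn χ) := by
  refine Finset.sum_congr rfl fun ω _ => ?_
  simp only [jointWeight, Pi.mul_apply]
  ring

theorem charSum_initial (ht : t ∈ Set.Icc (0 : ℝ) 1) (EX : Finset (Sym2 X)) (EZ : Finset (Sym2 Z))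
    (o : Z) (a b : X) (c d : Z) :
    (initial EX EZ o).charSum t (spinL Z a * spinL Z b * (spinR X c * spinR X d))
      = corr spin t EX a b * corr spin t EZ c d * (wsum spin t EX 1 * wsum spin t EZ 1) := by
  rw [mul_mul_mul_comm (corr spin t EX a b), corr_mul_wsum_one spin ht, corr_mul_wsum_one spin ht,
    ← sum_mul_weight_spinL_mul_weight_spinR, charSum]
  simp only [sgn_mul, jointWeight, initial, one_mul]
  rfl

namespace Valid

theorem charSum_nonneg (ht0 : 0 ≤ t) (hS : S.Valid (spinL Z) (spinR X) p EX EZ o)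
    (χ : PairConfig X Z →* ℤˣ) : 0 ≤ S.charSum t χ := by
  rw [charSum_eq_wsum]
  exact wsum_nonneg _ ht0 _ (mul_mem (mul_mem hS.factor_mem (weight_mem_griffithsCone _ ht0 _))
    (sgn_mem_griffithsCone χ))

theorem charSum_spinL_mul (hS : S.Valid (spinL Z) (spinR X) p EX EZ o) {k : Z}
    (hk : k ∈ S.explored) (χ : PairConfig X Z →* ℤˣ) :
    S.charSum t (spinL Z (p o) * spinL Z (p k) * χ) = S.charSum t (spinR X o * spinR X k * χ) := by
  have h := hS.mul_sgn_eq_of_agree hk (spinR X k * (spinL Z (p o) * χ))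
  rw [char_mul_mul_mul_cancel, mul_comm (spinL Z (p o)) (spinR X o), mul_left_comm (spinR X k),
    char_mul_mul_mul_cancel, mul_left_comm, ← mul_assoc, ← mul_assoc] at h
  rw [charSum_eq_wsum, charSum_eq_wsum, mul_right_comm, h, mul_right_comm]

theorem charSum_spinL (hS : S.Valid (spinL Z) (spinR X) p EX EZ o) {k : Z} (hk : k ∈ S.explored) :
    S.charSum t (spinL Z (p o) * spinL Z (p k)) = S.charSum t (spinR X o * spinR X k) := by
  simpa only [mul_one] using hS.charSum_spinL_mul (t := t) hk 1

/-- The first system may be flipped at the vertices with no explored vertex above them. -/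
theorem charSum_eq_zero (hp : IsCover p EX EZ) (hS : S.Valid (spinL Z) (spinR X) p EX EZ o)
    (hT : S.Terminal p) {x : X} (hx : ∀ k ∈ S.explored, p k ≠ x) :
    S.charSum t (spinL Z (p o) * spinL Z x) = 0 := by
  let A : Set X := {v | ∀ k ∈ S.explored, p k ≠ v}
  have hone : ∀ k ∈ S.explored, spinL Z (p k) (flip A, 1) = 1 := fun k hk =>
    spin_flip_of_notMem fun h => h k hk rfl
  have hneg : ∀ v ∈ A, spinL Z v (flip A, 1) = -1 := fun v hv => spin_flip_of_mem hv
  refine sum_sgn_mul_eq_zero (g := (flip A, 1)) ?_ fun ω => ?_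
  · rw [MonoidHom.mul_apply, hone o hS.root_mem, hneg x hx, one_mul]
  · have hbase : ∀ e ∈ S.baseEdges, edgeChar (spinL Z) e (flip A, 1) = 1 := fun e he =>
      edgeChar_eq_one_of_neg _ fun v hv => hneg v fun k hk h =>
        hS.notMem_of_terminal hp hT hk e he (h ▸ hv)
    have hcover : ∀ e ∈ S.coverEdges, edgeChar (spinR X) e (flip A, 1) = 1 := fun e _ =>
      edgeChar_eq_one _ fun v _ => rfl
    simp only [jointWeight, Pi.mul_apply]
    rw [weight_mul_of_edgeChar_eq_one _ hbase, weight_mul_of_edgeChar_eq_one _ hcover,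
      hS.factor_mul _ fun k hk => ⟨hone k hk, rfl⟩]

theorem charSum_le_fiber (ht0 : 0 ≤ t) (hp : IsCover p EX EZ)
    (hS : S.Valid (spinL Z) (spinR X) p EX EZ o) (hT : S.Terminal p) (x : X) :
    S.charSum t (spinL Z (p o) * spinL Z x)
      ≤ ∑ x' with p x' = x, S.charSum t (spinR X o * spinR X x') := by
  by_cases h : ∃ k ∈ S.explored, p k = x
  · obtain ⟨k, hk, rfl⟩ := h
    rw [hS.charSum_spinL hk]
    exact Finset.single_le_sum (f := fun x' => S.charSum t (spinR X o * spinR X x'))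
      (fun _ _ => hS.charSum_nonneg ht0 _) (by simp)
  · push Not at h
    rw [hS.charSum_eq_zero hp hT h]
    exact Finset.sum_nonneg fun _ _ => hS.charSum_nonneg ht0 _

theorem charSum_le_doubled (ht : t ∈ Set.Icc (0 : ℝ) 1) (hp : IsCover p EX EZ)
    (hS : S.Valid (spinL Z) (spinR X) p EX EZ o) (hT : S.Terminal p) {a : Z}
    (ha : a ∈ S.explored → a ∈ S.doubled p) :
    S.charSum t (spinR X o * spinR X a)
      ≤ ∑ y ∈ S.doubled p, corr spin t EZ a y * S.charSum t (spinR X o * spinR X y) := by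
  by_cases had : a ∈ S.doubled p
  · exact le_sum_corr_mul (G := fun y => S.charSum t (spinR X o * spinR X y)) spin ht EZ
      (fun y _ => hS.charSum_nonneg ht.1 _) had
  have haK : a ∉ S.explored := fun h => had (ha h)
  have hscreen := wsum_mul_sgn_le_of_separating (spinR X) ht
    (mul_mem hS.factor_mem (weight_mem_griffithsCone _ ht.1 _))
    (fun u hu => hS.exists_isFlip_spinR hu.1) o (hS.mem_screened_or_mem_doubled hp hT)
    (a := a) ⟨haK, had⟩
  have hroot : ∀ e ∈ inside S.coverEdges (S.screened p), o ∉ e :=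
    fun e he hoe => ((mem_inside.1 he).2 o hoe).1 hS.root_mem
  rw [corr_comm, corr_eq_zero _ (isFlip_spinR o) hroot fun h : a = o =>
    haK (h ▸ hS.root_mem), zero_mul, zero_add] at hscreen
  simp only [← charSum_eq_wsum, corr_spinR, mul_comm _ (spinR X o)] at hscreen
  exact hscreen.trans <| Finset.sum_le_sum fun y _ => mul_le_mul_of_nonneg_right
    (corr_mono spin ht ((touching_subset _ _).trans hS.coverEdges_subset) a y)
    (hS.charSum_nonneg ht.1 _)

theorem fiber_charSum_le (ht : t ∈ Set.Icc (0 : ℝ) 1) (hp : IsCover p EX EZ)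
    (hS : S.Valid (spinL Z) (spinR X) p EX EZ o) (hT : S.Terminal p) (x : X) :
    ∑ x' with p x' = x, S.charSum t (spinR X o * spinR X x')
      ≤ S.charSum t (spinL Z (p o) * spinL Z x) + ∑ x' with p x' = x,
        ∑ y ∈ S.doubled p, corr spin t EZ x' y * S.charSum t (spinR X o * spinR X y) := by
  have hnonneg (x' : Z) :
      0 ≤ ∑ y ∈ S.doubled p, corr spin t EZ x' y * S.charSum t (spinR X o * spinR X y) :=
    Finset.sum_nonneg fun y _ =>
      mul_nonneg (corr_nonneg _ ht EZ x' y) (hS.charSum_nonneg ht.1 _)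
  by_cases h : ∃ k ∈ S.explored, p k = x ∧ k ∉ S.doubled p
  · obtain ⟨k, hk, rfl, _⟩ := h
    have hmem : k ∈ Finset.univ.filter fun x' => p x' = p k := by simp
    rw [hS.charSum_spinL hk, ← Finset.add_sum_erase _ _ hmem]
    refine add_le_add le_rfl ((Finset.sum_le_sum fun x' hx' => ?_).trans
      (Finset.sum_le_sum_of_subset_of_nonneg (Finset.erase_subset k _) fun x' _ _ => hnonneg x'))
    rw [Finset.mem_erase, Finset.mem_filter_univ] at hx'
    exact hS.charSum_le_doubled ht hp hT fun _ => mem_doubled.2 ⟨k, hk, hx'.2.symm, hx'.1.symm⟩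
  · push Not at h
    exact le_add_of_nonneg_of_le (hS.charSum_nonneg ht.1 _) <| Finset.sum_le_sum fun x' hx' =>
      hS.charSum_le_doubled ht hp hT fun hk => h x' hk (Finset.mem_filter_univ x' |>.1 hx')

theorem corr_mul_charSum_le (ht : t ∈ Set.Icc (0 : ℝ) 1)
    (hS : S.Valid (spinL Z) (spinR X) p EX EZ o) (χ : PairConfig X Z →* ℤˣ) {a : Z}
    (ha : a ∉ S.explored) (b : Z) :
    corr spin t EZ a b * S.charSum t χ ≤ S.charSum t (χ * (spinR X a * spinR X b))
      + ∑ z ∈ S.explored, corr spin t EZ a z * corr spin t EZ z b * S.charSum t χ := by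
  have hinside : inside EZ {v | v ∉ S.explored} ⊆ S.coverEdges := fun e he => by
    by_contra hn
    obtain ⟨k, hk, hke⟩ := hS.touch e (mem_inside.1 he).1 hn
    exact (mem_inside.1 he).2 k hke hk
  have hfree : corr spin t (inside EZ {v | v ∉ S.explored}) a b * S.charSum t χ
      ≤ S.charSum t (χ * (spinR X a * spinR X b)) := by
    rw [charSum_eq_wsum, charSum_eq_wsum, sgn_mul χ, ← mul_assoc, ← corr_spinR (X := X)]
    exact corr_mul_wsum_le _ ht hinside a b (mul_mem (mul_mem hS.factor_mem
      (weight_mem_griffithsCone _ ht.1 _)) (sgn_mem_griffithsCone χ))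
  have hsimon := mul_le_mul_of_nonneg_right (corr_le_corr_inside_add spin ht
    (fun u => ⟨flip {u}, isFlip_spin u⟩) EZ ha b) (hS.charSum_nonneg ht.1 χ)
  rw [add_mul, Finset.sum_mul] at hsimon
  exact hsimon.trans (add_le_add hfree le_rfl)

theorem corr_mul_charSum_le_add_sum (ht : t ∈ Set.Icc (0 : ℝ) 1)
    (hS : S.Valid (spinL Z) (spinR X) p EX EZ o) (y y' : Z) :
    corr spin t EZ y' y * S.charSum t (spinL Z (p o) * spinL Z (p y'))
        + (if y' ∈ S.explored then S.charSum t (spinR X o * spinR X y) else 0)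
      ≤ S.charSum t (spinL Z (p o) * spinL Z (p y') * (spinR X y' * spinR X y))
        + ∑ z ∈ S.explored, corr spin t EZ y' z * corr spin t EZ z y
          * S.charSum t (spinL Z (p o) * spinL Z (p y')) := by
  split_ifs with h
  · rw [hS.charSum_spinL_mul h, char_mul_mul_mul_cancel, add_comm]
    simp only [mul_assoc]
    exact add_le_add_right (le_sum_corr_mul spin ht EZ (fun z _ => mul_nonneg
      (corr_nonneg spin ht EZ z y) (hS.charSum_nonneg ht.1 _)) h) _
  · rw [add_zero]
    exact hS.corr_mul_charSum_le ht _ h y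

end Valid

end Stage

namespace IsTerminalDecomposition

variable [DecidableEq X] [DecidableEq Z] {ι : Type} [Fintype ι]
  {l : ι → Stage (PairConfig X Z) X Z} {p : Z → X} {EX : Finset (Sym2 X)} {EZ : Finset (Sym2 Z)}
  {o : Z}

theorem sum_charSum {S : Stage (PairConfig X Z) X Z}
    (h : IsTerminalDecomposition (spinL Z) (spinR X) p t EX EZ o S l)
    (χ : PairConfig X Z →* ℤˣ) : ∑ i, (l i).charSum t χ = S.charSum t χ := by
  simp only [Stage.charSum, h.jointWeight_eq, Finset.sum_apply, Finset.mul_sum]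
  exact Finset.sum_comm

variable (h : IsTerminalDecomposition (spinL Z) (spinR X) p t EX EZ o (Stage.initial EX EZ o) l)

include h

theorem sum_charSum_spinL (ht : t ∈ Set.Icc (0 : ℝ) 1) (a b : X) :
    ∑ i, (l i).charSum t (spinL Z a * spinL Z b)
      = corr spin t EX a b * (wsum spin t EX 1 * wsum spin t EZ 1) := by
  simpa only [char_mul_self, mul_one, corr_self spin ht, h.sum_charSum] using
    Stage.charSum_initial ht EX EZ o a b o o

theorem sum_charSum_spinR (ht : t ∈ Set.Icc (0 : ℝ) 1) (c d : Z) :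
    ∑ i, (l i).charSum t (spinR X c * spinR X d)
      = corr spin t EZ c d * (wsum spin t EX 1 * wsum spin t EZ 1) := by
  simpa only [char_mul_self, one_mul, corr_self spin ht, h.sum_charSum] using
    Stage.charSum_initial ht EX EZ o (p o) (p o) c d

theorem sum_charSum_spinL_le (ht : t ∈ Set.Icc (0 : ℝ) 1) (z : Z) (v : X) :
    ∑ i with z ∈ (l i).explored, (l i).charSum t (spinL Z (p o) * spinL Z v)
      ≤ corr spin t EZ o z * corr spin t EX v (p z)
        * (wsum spin t EX 1 * wsum spin t EZ 1) := by
  have hterm : ∀ i, z ∈ (l i).explored → (l i).charSum t (spinL Z (p o) * spinL Z v)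
      = (l i).charSum t (spinL Z (p z) * spinL Z v * (spinR X o * spinR X z)) := fun i hi => by
    rw [mul_comm _ (spinR X o * _), ← (h.valid i).charSum_spinL_mul hi, char_mul_mul_mul_cancel]
  rw [Finset.sum_congr rfl fun i hi => hterm i (Finset.mem_filter.1 hi).2, corr_comm spin EX,
    mul_comm (corr spin t EZ o z), ← Stage.charSum_initial ht, ← h.sum_charSum]
  exact Finset.sum_le_sum_of_subset_of_nonneg (Finset.filter_subset _ _) fun i _ _ =>
    (h.valid i).charSum_nonneg ht.1 _

theorem sum_charSum_spinR_le (ht : t ∈ Set.Icc (0 : ℝ) 1) (y y' : Z) :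
    ∑ i with y' ∈ (l i).explored, (l i).charSum t (spinR X o * spinR X y)
      ≤ (∑ z, corr spin t EZ o z * corr spin t EZ y z * corr spin t EZ y' z
        * corr spin t EX (p y') (p z)) * (wsum spin t EX 1 * wsum spin t EZ 1) := by
  have hexplore := Finset.sum_le_sum fun i (_ : i ∈ Finset.univ) =>
    (h.valid i).corr_mul_charSum_le_add_sum ht y y'
  have hexchange : ∑ i, ∑ z ∈ (l i).explored, corr spin t EZ y' z * corr spin t EZ z y
        * (l i).charSum t (spinL Z (p o) * spinL Z (p y'))
      = ∑ z, corr spin t EZ y' z * corr spin t EZ z y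
        * ∑ i with z ∈ (l i).explored, (l i).charSum t (spinL Z (p o) * spinL Z (p y')) := by
    simp only [Finset.mul_sum]
    exact Finset.sum_comm' (by simp)
  rw [Finset.sum_add_distrib, Finset.sum_add_distrib, ← Finset.mul_sum, h.sum_charSum_spinL ht,
    h.sum_charSum, Stage.charSum_initial ht, ← Finset.sum_filter, hexchange, ← mul_assoc,
    mul_comm (corr spin t EZ y' y), add_le_add_iff_left] at hexplore
  rw [Finset.sum_mul]
  refine hexplore.trans (Finset.sum_le_sum fun z _ => ?_)
  refine (mul_le_mul_of_nonneg_left (h.sum_charSum_spinL_le ht z (p y'))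
    (mul_nonneg (corr_nonneg spin ht EZ y' z) (corr_nonneg spin ht EZ z y))).trans_eq ?_
  rw [corr_comm spin EZ z y]
  ring

theorem sum_doubled_le (ht : t ∈ Set.Icc (0 : ℝ) 1) (x' : Z) :
    ∑ i, ∑ y ∈ (l i).doubled p, corr spin t EZ x' y * (l i).charSum t (spinR X o * spinR X y)
      ≤ ∑ y, ∑ y' with p y' = p y ∧ y' ≠ y, corr spin t EZ x' y
        * ∑ i with y' ∈ (l i).explored, (l i).charSum t (spinR X o * spinR X y) := by
  rw [Finset.sum_comm' (t' := Finset.univ) (s' := fun y => {i | y ∈ (l i).doubled p}) (by simp)]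
  refine Finset.sum_le_sum fun y _ => ?_
  rw [← Finset.mul_sum, ← Finset.mul_sum]
  refine mul_le_mul_of_nonneg_left ?_ (corr_nonneg spin ht EZ x' y)
  simp only [Finset.sum_filter (fun _ => _ ∈ _)]
  rw [Finset.sum_comm]
  refine Finset.sum_le_sum fun i _ => ?_
  have hite (y' : Z) : 0 ≤ if y' ∈ (l i).explored then
      (l i).charSum t (spinR X o * spinR X y) else 0 := by
    split_ifs
    exacts [(h.valid i).charSum_nonneg ht.1 _, le_rfl]
  split_ifs with hy
  · obtain ⟨k, hk, hky⟩ := Stage.mem_doubled.1 hy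
    exact (if_pos hk).ge.trans
      (Finset.single_le_sum (fun y' _ => hite y') ((Finset.mem_filter_univ k).2 hky))
  · exact Finset.sum_nonneg fun y' _ => hite y'

end IsTerminalDecomposition

variable [DecidableEq X] [DecidableEq Z] {p : Z → X} {EX : Finset (Sym2 X)}
  {EZ : Finset (Sym2 Z)}

theorem corr_le_sum_fiber (ht : t ∈ Set.Icc (0 : ℝ) 1) (hp : IsCover p EX EZ) (o : Z) (x : X) :
    corr spin t EX (p o) x ≤ ∑ x' with p x' = x, corr spin t EZ o x' := by
  obtain ⟨ι, _, l, h⟩ := (Stage.valid_initial (s := spinL Z) (σ := spinR X) hp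
    o).exists_isTerminalDecomposition ht
  refine le_of_mul_le_mul_right ?_ (mul_pos (wsum_one_pos spin ht EX) (wsum_one_pos spin ht EZ))
  simp only [Finset.sum_mul, ← h.sum_charSum_spinL ht, ← h.sum_charSum_spinR ht]
  rw [Finset.sum_comm]
  exact Finset.sum_le_sum fun i _ => (h.valid i).charSum_le_fiber ht.1 hp (h.terminal i) x

theorem sum_fiber_le_corr_add (ht : t ∈ Set.Icc (0 : ℝ) 1) (hp : IsCover p EX EZ) (o : Z)
    (x : X) :
    ∑ x' with p x' = x, corr spin t EZ o x' ≤ corr spin t EX (p o) x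
      + ∑ x' with p x' = x, ∑ y, ∑ y' with p y' = p y ∧ y' ≠ y, ∑ z,
        corr spin t EZ o z * corr spin t EZ y z * corr spin t EZ y' z
          * corr spin t EX (p y') (p z) * corr spin t EZ x' y := by
  obtain ⟨ι, _, l, h⟩ := (Stage.valid_initial (s := spinL Z) (σ := spinR X) hp
    o).exists_isTerminalDecomposition ht
  let N := wsum spin t EX 1 * wsum spin t EZ 1
  have hfiber := Finset.sum_le_sum fun i (_ : i ∈ Finset.univ) =>
    (h.valid i).fiber_charSum_le ht hp (h.terminal i) x
  rw [Finset.sum_add_distrib, h.sum_charSum_spinL ht, Finset.sum_comm, Finset.sum_comm (γ := ι)]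
    at hfiber
  simp only [h.sum_charSum_spinR ht] at hfiber
  refine le_of_mul_le_mul_right ?_ (mul_pos (wsum_one_pos spin ht EX) (wsum_one_pos spin ht EZ))
  rw [add_mul, Finset.sum_mul, Finset.sum_mul]
  refine hfiber.trans (add_le_add le_rfl (Finset.sum_le_sum fun x' _ => ?_))
  calc ∑ i, ∑ y ∈ (l i).doubled p, corr spin t EZ x' y * (l i).charSum t (spinR X o * spinR X y)
      ≤ ∑ y, ∑ y' with p y' = p y ∧ y' ≠ y, corr spin t EZ x' y
        * ∑ i with y' ∈ (l i).explored, (l i).charSum t (spinR X o * spinR X y) :=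
      h.sum_doubled_le ht x'
    _ ≤ ∑ y, ∑ y' with p y' = p y ∧ y' ≠ y, corr spin t EZ x' y
        * ((∑ z, corr spin t EZ o z * corr spin t EZ y z * corr spin t EZ y' z
          * corr spin t EX (p y') (p z)) * N) :=
      Finset.sum_le_sum fun y _ => Finset.sum_le_sum fun y' _ =>
        mul_le_mul_of_nonneg_left (h.sum_charSum_spinR_le ht y y') (corr_nonneg spin ht EZ x' y)
    _ = _ := by
      simp only [Finset.sum_mul, Finset.mul_sum]
      refine Finset.sum_congr rfl fun y _ => Finset.sum_congr rfl fun y' _ =>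
        Finset.sum_congr rfl fun z _ => ?_
      ring

end Covering

/-! ### The two-point function as a correlation -/

section Graph

theorem card_mul_sum_comp {G H : Type*} [Group G] [Group H] [Fintype G] [Fintype H] {φ : G →* H}
    (hφ : Function.Surjective φ) (F : H → ℝ) :
    (Fintype.card H : ℝ) * ∑ g, F (φ g) = Fintype.card G * ∑ h, F h := by
  have htranslate : ∀ h, ∑ g, F (h * φ g) = ∑ g, F (φ g) := fun h => by
    obtain ⟨g₀, rfl⟩ := hφ h
    exact Fintype.sum_equiv (Equiv.mulLeft g₀) _ _ fun g => by simp
  have hsum : ∀ g, ∑ h, F (h * φ g) = ∑ h, F h := fun g =>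
    Fintype.sum_equiv (Equiv.mulRight (φ g)) _ _ fun _ => rfl
  calc (Fintype.card H : ℝ) * ∑ g, F (φ g) = ∑ h, ∑ g, F (h * φ g) := by simp [htranslate]
    _ = ∑ g, ∑ h, F (h * φ g) := Finset.sum_comm
    _ = Fintype.card G * ∑ h, F h := by simp [hsum]

variable {V V' : Type*} [Fintype V] [Fintype V'] {t β : ℝ}

section Embedding

variable [DecidableEq V] [DecidableEq V']

/-- The vertices outside the range of `ι` are isolated, so their spins integrate out. -/
theorem corr_map (ι : V ↪ V') (E : Finset (Sym2 V)) (a b : V) :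
    corr spin t (E.map ι.sym2Map) (ι a) (ι b) = corr spin t E a b := by
  let φ : (V' → ℤˣ) →* (V → ℤˣ) := MonoidHom.pi fun v => spin (ι v)
  have hφ : Function.Surjective φ := ι.injective.surjective_comp_right
  have hweight : ∀ ρ, weight spin t (E.map ι.sym2Map) ρ = weight spin t E (φ ρ) := fun ρ => by
    rw [weight, Finset.prod_map]
    refine Finset.prod_congr rfl fun e _ => ?_
    induction e with
    | _ x y => rfl
  have hwsum : ∀ F : (V → ℤˣ) → ℝ, (Fintype.card (V → ℤˣ) : ℝ)
      * wsum spin t (E.map ι.sym2Map) (F ∘ φ) = Fintype.card (V' → ℤˣ) * wsum spin t E F := by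
    intro F
    simpa only [wsum, hweight, Function.comp_apply] using
      card_mul_sum_comp hφ fun ω => F ω * weight spin t E ω
  have hcard : (Fintype.card (V → ℤˣ) : ℝ) ≠ 0 := Nat.cast_ne_zero.2 Fintype.card_ne_zero
  have hcard' : (Fintype.card (V' → ℤˣ) : ℝ) ≠ 0 := Nat.cast_ne_zero.2 Fintype.card_ne_zero
  calc corr spin t (E.map ι.sym2Map) (ι a) (ι b)
      = wsum spin t (E.map ι.sym2Map) (sgn (spin a * spin b) ∘ φ)
        / wsum spin t (E.map ι.sym2Map) ((1 : (V → ℤˣ) → ℝ) ∘ φ) := rfl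
    _ = corr spin t E a b := by
      rw [← mul_div_mul_left _ _ hcard, hwsum, hwsum, mul_div_mul_left _ _ hcard', corr]

theorem corr_le_of_map_subset (ht : t ∈ Set.Icc (0 : ℝ) 1) {ι : V ↪ V'} {E : Finset (Sym2 V)}
    {E' : Finset (Sym2 V')} (h : E.map ι.sym2Map ⊆ E') (a b : V) :
    corr spin t E a b ≤ corr spin t E' (ι a) (ι b) :=
  (corr_map ι E a b).ge.trans (corr_mono spin ht h _ _)

theorem corr_le_of_subset_map (ht : t ∈ Set.Icc (0 : ℝ) 1) {ι : V ↪ V'} {E : Finset (Sym2 V)}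
    {E' : Finset (Sym2 V')} (h : E' ⊆ E.map ι.sym2Map) (a b : V) :
    corr spin t E' (ι a) (ι b) ≤ corr spin t E a b :=
  (corr_mono spin ht h _ _).trans (corr_map ι E a b).le

end Embedding

theorem le_corr_of_mem {V Ω : Type*} [CommGroup Ω] [Fintype Ω] (σ : V → Ω →* ℤˣ)
    (ht : t ∈ Set.Icc (0 : ℝ) 1) {E : Finset (Sym2 V)} {a b : V} (h : s(a, b) ∈ E) :
    t ≤ corr σ t E a b := by
  classical
  have hrec := one_add_mul_corr_eq σ ht h b
  rw [corr_self σ ht, mul_one] at hrec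
  have h0 := corr_nonneg σ ht (E.erase s(a, b)) a b
  have htt : t * t ≤ 1 := mul_le_one₀ ht.2 ht.1 ht.2
  refine le_of_mul_le_mul_left ?_ (add_pos_of_pos_of_nonneg one_pos (mul_nonneg ht.1 h0))
  rw [hrec]
  nlinarith

open Classical in
/-- The set of edges of a finite graph; unlike `SimpleGraph.edgeFinset` it needs no decidability
assumption on the graph. -/
def edges (G : SimpleGraph V) : Finset (Sym2 V) := G.edgeFinset

theorem mk_mem_edges {G : SimpleGraph V} {a b : V} : s(a, b) ∈ edges G ↔ G.Adj a b := by
  classical exact SimpleGraph.mem_edgeFinset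

theorem exp_mul_sgn {Ω : Type*} [CommGroup Ω] (β : ℝ) (χ : Ω →* ℤˣ) (ω : Ω) :
    Real.exp (β * sgn χ ω) = Real.cosh β * (1 + Real.tanh β * sgn χ ω) := by
  rw [mul_add, mul_one, ← mul_assoc, Real.tanh_eq_sinh_div_cosh,
    mul_div_cancel₀ _ (Real.cosh_pos β).ne']
  rcases sgn_eq_one_or χ ω with h | h <;> rw [h]
  · rw [mul_one, mul_one, Real.cosh_add_sinh]
  · rw [mul_neg_one, mul_neg_one, ← sub_eq_add_neg, Real.cosh_sub_sinh]

theorem exp_hamiltonian (G : SimpleGraph V) (β : ℝ) (ω : V → ℤˣ) :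
    Real.exp (-β * hamiltonian G ω)
      = Real.cosh β ^ (edges G).card * weight spin (Real.tanh β) (edges G) ω := by
  have hspin : ∀ e : Sym2 V, edgeSpin ω e = sgn (edgeChar spin e) ω := fun e => by
    induction e with
    | _ x y => simp [edgeSpin, edgeChar, sgn, spin]
  rw [hamiltonian, neg_mul_neg, Finset.mul_sum, Real.exp_sum, weight, ← Finset.prod_const,
    ← Finset.prod_mul_distrib]
  exact Finset.prod_congr rfl fun e _ => by rw [hspin, exp_mul_sgn]

theorem sum_mul_exp_hamiltonian [DecidableEq V] (G : SimpleGraph V) (β : ℝ) (F : (V → ℤˣ) → ℝ) :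
    ∑ ω, F ω * Real.exp (-β * hamiltonian G ω)
      = Real.cosh β ^ (edges G).card * wsum spin (Real.tanh β) (edges G) F := by
  simp only [exp_hamiltonian, wsum, Finset.mul_sum, mul_left_comm]

theorem twoPoint_eq_corr [DecidableEq V] (G : SimpleGraph V) (β : ℝ) (a b : V) :
    twoPoint G β a b = corr spin (Real.tanh β) (edges G) a b := by
  have hdec : ‹DecidableEq V› = fun a b => Classical.propDecidable (a = b) := Subsingleton.elim _ _
  subst hdec
  classical
  have hcosh : Real.cosh β ^ (edges G).card ≠ 0 := (pow_pos (Real.cosh_pos β) _).ne'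
  have hZ : partitionFunction G β
      = ∑ ω, (1 : (V → ℤˣ) → ℝ) ω * Real.exp (-β * hamiltonian G ω) := by
    simp only [partitionFunction, Pi.one_apply, one_mul]
  have hspin : (fun ω : V → ℤˣ => ((ω a : ℤ) : ℝ) * ((ω b : ℤ) : ℝ)) = sgn (spin a * spin b) := by
    ext ω
    simp [sgn, spin]
  unfold twoPoint expectation
  rw [hZ, hspin, sum_mul_exp_hamiltonian, sum_mul_exp_hamiltonian,
    one_div_mul_eq_div, mul_div_mul_left _ _ hcosh, corr]

theorem tanh_pos (hβ : 0 < β) : 0 < Real.tanh β := by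
  rw [Real.tanh_eq_sinh_div_cosh]
  exact div_pos (Real.sinh_pos_iff.2 hβ) (Real.cosh_pos β)

theorem tanh_mem_Icc (hβ : 0 ≤ β) : Real.tanh β ∈ Set.Icc (0 : ℝ) 1 := by
  refine ⟨?_, (Real.tanh_lt_one β).le⟩
  rw [Real.tanh_eq_sinh_div_cosh]
  exact div_nonneg (Real.sinh_nonneg_iff.2 hβ) (Real.cosh_pos β).le

theorem twoPoint_nonneg (hβ : 0 ≤ β) (G : SimpleGraph V) (a b : V) : 0 ≤ twoPoint G β a b := by
  classical exact (corr_nonneg _ (tanh_mem_Icc hβ) _ _ _).trans_eq (twoPoint_eq_corr G β a b).symm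

theorem twoPoint_le_one (hβ : 0 ≤ β) (G : SimpleGraph V) (a b : V) : twoPoint G β a b ≤ 1 := by
  classical exact (twoPoint_eq_corr G β a b).trans_le (corr_le_one _ (tanh_mem_Icc hβ) _ _ _)

theorem twoPoint_self (hβ : 0 ≤ β) (G : SimpleGraph V) (a : V) : twoPoint G β a a = 1 := by
  classical exact (twoPoint_eq_corr G β a a).trans (corr_self _ (tanh_mem_Icc hβ) _ _)

theorem twoPoint_comm (G : SimpleGraph V) (β : ℝ) (a b : V) :
    twoPoint G β a b = twoPoint G β b a := by
  classical rw [twoPoint_eq_corr, twoPoint_eq_corr, corr_comm]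

theorem twoPoint_mul_le (hβ : 0 ≤ β) (G : SimpleGraph V) (a b c : V) :
    twoPoint G β a b * twoPoint G β b c ≤ twoPoint G β a c := by
  classical
  simp only [twoPoint_eq_corr]
  exact corr_mul_corr_le _ (tanh_mem_Icc hβ) _ _ _ _

theorem tanh_le_twoPoint (hβ : 0 ≤ β) {G : SimpleGraph V} {a b : V} (h : G.Adj a b) :
    Real.tanh β ≤ twoPoint G β a b := by
  classical
  rw [twoPoint_eq_corr]
  exact le_corr_of_mem _ (tanh_mem_Icc hβ) (mk_mem_edges.2 h)

theorem twoPoint_le_of_le_comap (hβ : 0 ≤ β) {G : SimpleGraph V} {G' : SimpleGraph V'} {ι : V ↪ V'}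
    (h : G ≤ G'.comap ι) (a b : V) : twoPoint G β a b ≤ twoPoint G' β (ι a) (ι b) := by
  classical
  rw [twoPoint_eq_corr, twoPoint_eq_corr]
  refine corr_le_of_map_subset (tanh_mem_Icc hβ) (Finset.map_subset_iff_subset_preimage.2 ?_) a b
  intro e he
  induction e with
  | _ x y =>
    exact Finset.mem_preimage.2 (mk_mem_edges.2 (h (mk_mem_edges.1 he)))

theorem touching_subset_map {G : SimpleGraph V} {G' : SimpleGraph V'} {ι : V' ↪ V} {U : Set V'}
    (hadj : ∀ a ∈ U, ∀ w, G.Adj (ι a) w → ∃ a', ι a' = w ∧ G'.Adj a a') :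
    touching (edges G) (ι '' U) ⊆ (touching (edges G') U).map ι.sym2Map := by
  intro e he
  obtain ⟨he, _, ⟨w, rfl⟩, a, ha, rfl⟩ := mem_touching.1 he
  obtain ⟨a', rfl, ha'⟩ := hadj a ha w (mk_mem_edges.1 he)
  exact Finset.mem_map_of_mem ι.sym2Map
    (mem_touching.2 ⟨mk_mem_edges.2 ha', a, Sym2.mem_mk_left a a', ha⟩)

theorem twoPoint_le_of_embedded (hβ : 0 ≤ β) [DecidableEq V] [DecidableEq V'] (G : SimpleGraph V)
    (G' : SimpleGraph V') (ι : V' ↪ V) (U : Finset V')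
    (hadj : ∀ a ∈ U, ∀ w, G.Adj (ι a) w → ∃ a', ι a' = w ∧ G'.Adj a a') {o : V'} (ho : o ∈ U)
    (b : V) :
    twoPoint G β (ι o) b ≤ ∑ a with a ∈ U ∧ ι a = b, twoPoint G' β o a
      + ∑ y ∈ Uᶜ, twoPoint G' β o y * twoPoint G β (ι y) b := by
  have ht := tanh_mem_Icc hβ
  let W : Set V := ι '' U
  have hflip : ∀ u : V, ∃ g, IsFlip spin u g := fun u => ⟨_, isFlip_spin u⟩
  have hsub : touching (edges G) W ⊆ (touching (edges G') U).map ι.sym2Map :=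
    touching_subset_map hadj
  have hboundary : ∀ e ∈ touching (edges G) W, ∀ v ∈ e, v ∈ W ∨ v ∈ Uᶜ.map ι := by
    intro e he v hv
    obtain ⟨e', -, rfl⟩ := Finset.mem_map.1 (hsub he)
    obtain ⟨a, -, rfl⟩ := Sym2.mem_map.1 hv
    exact (em (a ∈ U)).imp (fun h => ⟨a, h, rfl⟩) fun h =>
      Finset.mem_map_of_mem ι (Finset.mem_compl.2 h)
  have htouching : ∀ y, corr spin (Real.tanh β) (touching (edges G) W) (ι o) (ι y)
      ≤ twoPoint G' β o y := fun y => by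
    rw [twoPoint_eq_corr]
    exact corr_le_of_subset_map ht (hsub.trans (Finset.map_subset_map.2 (touching_subset _ _))) o y
  have hinside : corr spin (Real.tanh β) (inside (edges G) W) (ι o) b
      ≤ ∑ a with a ∈ U ∧ ι a = b, twoPoint G' β o a := by
    by_cases hb : b ∈ W
    · obtain ⟨a, ha, rfl⟩ := hb
      rw [← inside_touching]
      refine (corr_mono spin ht (inside_subset _ W) _ _).trans ((htouching a).trans ?_)
      exact Finset.single_le_sum (f := twoPoint G' β o) (fun a _ => twoPoint_nonneg hβ G' o a)
        (Finset.mem_filter.2 ⟨Finset.mem_univ _, ha, rfl⟩)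
    · rw [corr_comm, corr_eq_zero spin (isFlip_spin b)
        (fun e he hbe => hb ((mem_inside.1 he).2 b hbe)) fun h => hb ⟨o, ho, h⟩]
      exact Finset.sum_nonneg fun a _ => twoPoint_nonneg hβ _ _ _
  have hsimon := corr_le_of_separating spin ht hflip hboundary ⟨o, ho, rfl⟩ b
  simp only [Finset.sum_map, ← twoPoint_eq_corr] at hsimon
  exact hsimon.trans (add_le_add hinside (Finset.sum_le_sum fun y _ =>
    mul_le_mul_of_nonneg_right (htouching y) (twoPoint_nonneg hβ _ _ _)))

end Graph

/-! ### Nearest-neighbour graphs and coverings of tori -/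

section NearestNeighbour

variable {A B : Type*} [CommRing A] [CommRing B] {d : ℕ}

/-- The vectors `± e_i`, along which the edges of the nearest-neighbour graph run. -/
def IsUnitStep (s : Fin d → A) : Prop := ∃ i, s = Pi.single i 1 ∨ s = -Pi.single i 1

theorem comp_single_one (f : A →+* B) (i : Fin d) :
    f ∘ (Pi.single i 1 : Fin d → A) = Pi.single i 1 := by
  ext j
  simp [Pi.single_apply, apply_ite f]

theorem comp_neg_single_one (f : A →+* B) (i : Fin d) :
    f ∘ (-Pi.single i 1 : Fin d → A) = -Pi.single i 1 := by
  rw [← comp_single_one f i]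
  exact map_neg (f.compLeft (Fin d)) _

theorem IsUnitStep.map {s : Fin d → A} (h : IsUnitStep s) (f : A →+* B) : IsUnitStep (f ∘ s) := by
  obtain ⟨i, rfl | rfl⟩ := h
  exacts [⟨i, Or.inl (comp_single_one f i)⟩, ⟨i, Or.inr (comp_neg_single_one f i)⟩]

theorem IsUnitStep.exists_map_eq {s : Fin d → B} (h : IsUnitStep s) (f : A →+* B) :
    ∃ s' : Fin d → A, IsUnitStep s' ∧ f ∘ s' = s := by
  obtain ⟨i, rfl | rfl⟩ := h
  exacts [⟨_, ⟨i, Or.inl rfl⟩, comp_single_one f i⟩, ⟨_, ⟨i, Or.inr rfl⟩, comp_neg_single_one f i⟩]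

theorem IsUnitStep.eq_of_map_eq [Nontrivial B] {s s' : Fin d → A} (h : IsUnitStep s)
    (h' : IsUnitStep s') (f : A →+* B) (hB : (-1 : B) ≠ 1) (heq : f ∘ s = f ∘ s') : s = s' := by
  obtain ⟨i, hi⟩ := h
  obtain ⟨j, hj⟩ := h'
  have hij := congrFun heq i
  obtain rfl | hne := eq_or_ne i j
  · rcases hi with rfl | rfl <;> rcases hj with rfl | rfl
    · rfl
    · exact absurd (by simpa using hij.symm) hB
    · exact absurd (by simpa using hij) hB
    · rfl
  · rcases hi with rfl | rfl <;> rcases hj with rfl | rfl <;>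
    simp [Pi.single_eq_of_ne hne] at hij

theorem IsUnitStep.ne_zero [Nontrivial A] {s : Fin d → A} (h : IsUnitStep s) : s ≠ 0 := by
  obtain ⟨i, rfl | rfl⟩ := h <;> simp

theorem nnGraph_adj [Nontrivial A] {x y : Fin d → A} :
    (nnGraph A d).Adj x y ↔ IsUnitStep (y - x) := by
  have hsingle : ∀ i, y - x = Pi.single i 1 ↔ y = x + Pi.single i 1 := fun i => sub_eq_iff_eq_add'
  have hneg : ∀ i, y - x = -Pi.single i 1 ↔ x = y + Pi.single i 1 := fun i => by
    rw [← neg_sub, neg_inj, sub_eq_iff_eq_add']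
  rw [nnGraph, SimpleGraph.fromRel_adj, ← exists_or]
  simp only [IsUnitStep, hsingle, hneg, and_iff_right_iff_imp]
  rintro ⟨i, h⟩ rfl
  exact IsUnitStep.ne_zero (s := x - x) ⟨i, h.imp (hsingle i).2 (hneg i).2⟩ (sub_self x)

theorem isCover_nnGraph [Fintype A] [Fintype B] [Nontrivial B] (f : A →+* B)
    (hB : (-1 : B) ≠ 1) :
    IsCover (f.compLeft (Fin d)) (edges (nnGraph B d)) (edges (nnGraph A d)) := by
  have : Nontrivial A := f.domain_nontrivial
  refine ⟨fun e he => ?_, fun k w w' h h' hw => ?_, fun k b h => ?_⟩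
  · induction e with
    | _ x y =>
      rw [mk_mem_edges, nnGraph_adj] at he
      rw [Sym2.map_mk, mk_mem_edges, nnGraph_adj, ← map_sub]
      exact he.map f
  · rw [mk_mem_edges, nnGraph_adj] at h h'
    refine sub_left_injective (h.eq_of_map_eq h' f hB ?_)
    change f.compLeft (Fin d) (w - k) = f.compLeft (Fin d) (w' - k)
    rw [map_sub, map_sub, hw]
  · rw [mk_mem_edges, nnGraph_adj] at h
    obtain ⟨s, hs, hsb⟩ := h.exists_map_eq f
    refine ⟨k + s, ?_, ?_⟩
    · rw [map_add, ← eq_sub_iff_add_eq', ← hsb]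
      rfl
    · rwa [mk_mem_edges, nnGraph_adj, add_sub_cancel_left]

theorem twoPoint_nnGraph_add [Fintype A] [Nontrivial A] {β : ℝ} (hβ : 0 ≤ β) (a b c : Fin d → A) :
    twoPoint (nnGraph A d) β (c + a) (c + b) = twoPoint (nnGraph A d) β a b := by
  have hle : ∀ a b c : Fin d → A, twoPoint (nnGraph A d) β a b
      ≤ twoPoint (nnGraph A d) β (c + a) (c + b) := fun a b c =>
    twoPoint_le_of_le_comap hβ (ι := addLeftEmbedding c) (fun x y hxy => by
      rw [SimpleGraph.comap_adj, nnGraph_adj]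
      simpa [nnGraph_adj] using hxy) a b
  refine le_antisymm ?_ (hle a b c)
  simpa using hle (c + a) (c + b) (-c)

section Torus

variable {r : ℕ} [NeZero r] [Fact (1 < r)] {β : ℝ}

theorem twoPoint_eq_torusTau (hβ : 0 ≤ β) (a b : Fin d → ZMod r) :
    twoPoint (nnGraph (ZMod r) d) β a b = torusTau d r β (a - b) := by
  rw [torusTau, twoPoint_comm, ← twoPoint_nnGraph_add hβ 0 (a - b) b, add_zero, add_sub_cancel]

theorem torusTau_neg (hβ : 0 ≤ β) (a : Fin d → ZMod r) :
    torusTau d r β (-a) = torusTau d r β a := by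
  rw [← zero_sub, ← twoPoint_eq_torusTau hβ, torusTau]

end Torus

section TorusCovering

variable {r M : ℕ} [NeZero r] [NeZero M] [Fact (2 < r)] {β : ℝ}

/-- The covering `𝕋_M → 𝕋_r` of a torus by a larger one, for `r ∣ M`. -/
def reduceHom (d : ℕ) {r M : ℕ} (h : r ∣ M) : (Fin d → ZMod M) →+ (Fin d → ZMod r) :=
  ((ZMod.castHom h (ZMod r)).compLeft (Fin d) : (Fin d → ZMod M) →+* (Fin d → ZMod r))

theorem isCover_reduceHom (h : r ∣ M) :
    IsCover (reduceHom d h) (edges (nnGraph (ZMod r) d)) (edges (nnGraph (ZMod M) d)) :=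
  have : Fact (1 < r) := ⟨one_lt_two.trans Fact.out⟩
  isCover_nnGraph (ZMod.castHom h (ZMod r)) ZMod.neg_one_ne_one

theorem torusTau_le_sum_fiber (hβ : 0 ≤ β) (h : r ∣ M) (x : Fin d → ZMod r) :
    torusTau d r β x ≤ ∑ x' with reduceHom d h x' = x, torusTau d M β x' := by
  have hcover := corr_le_sum_fiber (tanh_mem_Icc hβ) (isCover_reduceHom (d := d) h) 0 x
  rw [map_zero] at hcover
  simpa only [← twoPoint_eq_corr, torusTau] using hcover

theorem sum_fiber_torusTau_le (hβ : 0 ≤ β) (h : r ∣ M) (x : Fin d → ZMod r) :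
    ∑ x' with reduceHom d h x' = x, torusTau d M β x' ≤ torusTau d r β x
      + ∑ x' with reduceHom d h x' = x, ∑ y, ∑ y' with reduceHom d h y' = reduceHom d h y ∧ y' ≠ y,
        ∑ z, torusTau d M β z * torusTau d M β (y - z) * torusTau d M β (y' - z)
          * torusTau d r β (reduceHom d h y' - reduceHom d h z) * torusTau d M β (x' - y) := by
  have hr : Fact (1 < r) := ⟨one_lt_two.trans Fact.out⟩
  have : Fact (1 < M) := ⟨hr.out.trans_le (Nat.le_of_dvd (NeZero.pos M) h)⟩
  have hcover := sum_fiber_le_corr_add (tanh_mem_Icc hβ) (isCover_reduceHom (d := d) h) 0 x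
  rw [map_zero] at hcover
  simpa only [← twoPoint_eq_corr, twoPoint_eq_torusTau hβ, zero_sub, torusTau_neg hβ] using hcover

end TorusCovering

end NearestNeighbour

/-! ### The infinite-volume two-point function -/

section InfiniteVolume

variable {d : ℕ} {β : ℝ}

theorem mem_box_of_abs_lt {R : ℕ} {x : Fin d → ℤ} (h : ∀ i, 2 * |x i| < R) : x ∈ box d R := by
  refine mem_box.2 fun i => ?_
  have hi : 2 * |(x i : ℝ)| < R := by exact_mod_cast h i
  constructor <;> linarith [neg_abs_le (x i : ℝ), le_abs_self (x i : ℝ)]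

theorem exists_mem_box (x : Fin d → ℤ) : ∃ R, x ∈ box d R := by
  refine ⟨2 * ∑ i, (x i).natAbs + 1, mem_box_of_abs_lt fun i => ?_⟩
  have h : (x i).natAbs ≤ ∑ j, (x j).natAbs :=
    Finset.single_le_sum (f := fun j => (x j).natAbs) (fun _ _ => Nat.zero_le _) (Finset.mem_univ i)
  rw [Int.abs_eq_natAbs]
  exact_mod_cast (by omega : 2 * (x i).natAbs < 2 * ∑ j, (x j).natAbs + 1)

theorem box_mono {R R' : ℕ} (h : R ≤ R') : box d R ⊆ box d R' := by
  intro x hx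
  have h' : (R : ℝ) ≤ R' := by exact_mod_cast h
  exact mem_box.2 fun i => ⟨by linarith [(mem_box.1 hx i).1], by linarith [(mem_box.1 hx i).2]⟩

theorem eventually_subset_box (F : Finset (Fin d → ℤ)) : ∀ᶠ R in atTop, F ⊆ box d R := by
  choose f hf using exists_mem_box (d := d)
  filter_upwards [eventually_ge_atTop (F.sup f)] with R hR x hx
  exact box_mono ((Finset.le_sup hx).trans hR) (hf x)

theorem zero_mem_box {R : ℕ} (h : 1 ≤ R) : (0 : Fin d → ℤ) ∈ box d R :=
  mem_box_of_abs_lt fun i => by simpa using Nat.lt_of_lt_of_le Nat.zero_lt_one h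

theorem IsUnitStep.abs_le_one {s : Fin d → ℤ} (hs : IsUnitStep s) (i : Fin d) : |s i| ≤ 1 := by
  obtain ⟨j, rfl | rfl⟩ := hs <;> obtain rfl | h := eq_or_ne i j <;> simp [*]

theorem add_mem_box {L : ℕ} {a s : Fin d → ℤ} (ha : a ∈ box d L) (hs : IsUnitStep s) :
    a + s ∈ box d (L + 2) := by
  refine mem_box.2 fun i => ?_
  have hi : |(s i : ℝ)| ≤ 1 := by exact_mod_cast hs.abs_le_one i
  obtain ⟨hneg, hpos⟩ := abs_le.1 hi
  obtain ⟨hlo, hhi⟩ := mem_box.1 ha i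
  push_cast [Pi.add_apply]
  constructor <;> linarith

theorem boxTwoPoint_of_mem {R : ℕ} {x y : Fin d → ℤ} (hx : x ∈ box d R) (hy : y ∈ box d R) :
    boxTwoPoint d R β x y = twoPoint (boxGraph d R) β ⟨x, hx⟩ ⟨y, hy⟩ :=
  dif_pos ⟨hx, hy⟩

theorem boxTwoPoint_of_notMem {R : ℕ} {x y : Fin d → ℤ} (h : ¬(x ∈ box d R ∧ y ∈ box d R)) :
    boxTwoPoint d R β x y = 0 := dif_neg h

theorem boxTwoPoint_nonneg (hβ : 0 ≤ β) (R : ℕ) (x y : Fin d → ℤ) :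
    0 ≤ boxTwoPoint d R β x y := by
  rw [boxTwoPoint]
  split_ifs
  exacts [twoPoint_nonneg hβ _ _ _, le_rfl]

theorem boxTwoPoint_le_one (hβ : 0 ≤ β) (R : ℕ) (x y : Fin d → ℤ) :
    boxTwoPoint d R β x y ≤ 1 := by
  rw [boxTwoPoint]
  split_ifs
  exacts [twoPoint_le_one hβ _ _ _, zero_le_one]

theorem boxGraph_adj {R : ℕ} {x y : box d R} :
    (boxGraph d R).Adj x y ↔ IsUnitStep (y.1 - x.1) := by
  rw [boxGraph, SimpleGraph.comap_adj, nnGraph_adj]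

theorem boxTwoPoint_le_add (hβ : 0 ≤ β) {R R' : ℕ} {c : Fin d → ℤ}
    (h : ∀ v ∈ box d R, v + c ∈ box d R') (a b : Fin d → ℤ) :
    boxTwoPoint d R β a b ≤ boxTwoPoint d R' β (a + c) (b + c) := by
  by_cases hab : a ∈ box d R ∧ b ∈ box d R
  · rw [boxTwoPoint_of_mem hab.1 hab.2, boxTwoPoint_of_mem (h a hab.1) (h b hab.2)]
    let ι : box d R ↪ box d R' := (addRightEmbedding c).subtypeMap h
    refine twoPoint_le_of_le_comap hβ (ι := ι) (fun v w hvw => ?_) ⟨a, hab.1⟩ ⟨b, hab.2⟩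
    rw [boxGraph_adj] at hvw
    rw [SimpleGraph.comap_adj, boxGraph_adj]
    exact (add_sub_add_right_eq_sub w.1 v.1 c).symm ▸ hvw
  · rw [boxTwoPoint_of_notMem hab]
    exact boxTwoPoint_nonneg hβ _ _ _

theorem boxTwoPoint_mono (hβ : 0 ≤ β) (a b : Fin d → ℤ) :
    Monotone fun R => boxTwoPoint d R β a b := fun R R' h => by
  simpa using boxTwoPoint_le_add hβ (c := 0) (fun v hv => by simpa using box_mono h hv) a b

theorem tendsto_boxTwoPoint (hβ : 0 ≤ β) (x : Fin d → ℤ) :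
    Tendsto (fun R => boxTwoPoint d R β 0 x) atTop (nhds (tau d β x)) := by
  refine tendsto_nhds_limUnder ⟨_, tendsto_atTop_ciSup (boxTwoPoint_mono hβ 0 x) ⟨1, ?_⟩⟩
  rintro _ ⟨R, rfl⟩
  exact boxTwoPoint_le_one hβ R 0 x

theorem boxTwoPoint_le_tau (hβ : 0 ≤ β) (R : ℕ) (x : Fin d → ℤ) :
    boxTwoPoint d R β 0 x ≤ tau d β x :=
  (boxTwoPoint_mono hβ 0 x).ge_of_tendsto (tendsto_boxTwoPoint hβ x) R

theorem tau_nonneg (hβ : 0 ≤ β) (x : Fin d → ℤ) : 0 ≤ tau d β x :=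
  (boxTwoPoint_nonneg hβ 0 0 x).trans (boxTwoPoint_le_tau hβ 0 x)

theorem tau_zero (hβ : 0 ≤ β) : tau d β 0 = 1 := by
  refine tendsto_nhds_unique (tendsto_boxTwoPoint hβ 0) (tendsto_const_nhds.congr' ?_)
  filter_upwards [eventually_ge_atTop 1] with R hR
  rw [boxTwoPoint_of_mem (zero_mem_box hR) (zero_mem_box hR), twoPoint_self hβ]

theorem boxTwoPoint_mul_le (hβ : 0 ≤ β) (R : ℕ) (a b c : Fin d → ℤ) :
    boxTwoPoint d R β a b * boxTwoPoint d R β b c ≤ boxTwoPoint d R β a c := by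
  have hnonneg := boxTwoPoint_nonneg hβ R a c
  by_cases hab : a ∈ box d R ∧ b ∈ box d R
  · by_cases hbc : b ∈ box d R ∧ c ∈ box d R
    · rw [boxTwoPoint_of_mem hab.1 hab.2, boxTwoPoint_of_mem hbc.1 hbc.2,
        boxTwoPoint_of_mem hab.1 hbc.2]
      exact twoPoint_mul_le hβ _ _ _ _
    · rwa [boxTwoPoint_of_notMem hbc, mul_zero]
  · rwa [boxTwoPoint_of_notMem hab, zero_mul]

theorem tau_mul_le (hβ : 0 ≤ β) (a b : Fin d → ℤ) :
    tau d β a * tau d β b ≤ tau d β (a + b) := by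
  refine le_of_tendsto ((tendsto_boxTwoPoint hβ b).const_mul (tau d β a))
    (Eventually.of_forall fun R' => ?_)
  refine le_of_tendsto_of_tendsto ((tendsto_boxTwoPoint hβ a).mul_const _)
    (tendsto_boxTwoPoint hβ (a + b)) ?_
  filter_upwards [eventually_subset_box ((box d R').image (· + a))] with R hR
  have hshift := boxTwoPoint_le_add hβ (c := a) (fun v hv => hR (Finset.mem_image_of_mem _ hv)) 0 b
  rw [zero_add, add_comm b] at hshift
  exact (mul_le_mul_of_nonneg_left hshift (boxTwoPoint_nonneg hβ _ _ _)).trans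
    (boxTwoPoint_mul_le hβ R 0 a (a + b))

theorem tanh_le_tau (hβ : 0 ≤ β) {s : Fin d → ℤ} (hs : IsUnitStep s) :
    Real.tanh β ≤ tau d β s := by
  have hzero : (0 : Fin d → ℤ) ∈ box d 3 := zero_mem_box (by norm_num)
  have hmem : s ∈ box d 3 := by simpa using add_mem_box (zero_mem_box le_rfl) hs
  refine le_trans ?_ (boxTwoPoint_le_tau hβ 3 s)
  rw [boxTwoPoint_of_mem hzero hmem]
  exact tanh_le_twoPoint hβ (boxGraph_adj.2 (by simpa using hs))

theorem closure_isUnitStep (d : ℕ) :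
    AddSubmonoid.closure {s : Fin d → ℤ | IsUnitStep s} = ⊤ := by
  refine eq_top_iff.2 fun x _ => ?_
  rw [← Finset.univ_sum_single x]
  refine sum_mem fun i _ => ?_
  have hgen : ∀ s : Fin d → ℤ, IsUnitStep s → s ∈ AddSubmonoid.closure {s | IsUnitStep s} :=
    fun s hs => AddSubmonoid.subset_closure hs
  have hsmul : ∀ c : ℤ, Pi.single i c = c • (Pi.single i 1 : Fin d → ℤ) := fun c => by
    rw [← Pi.single_smul, smul_eq_mul, mul_one]
  obtain ⟨n, hn | hn⟩ := Int.eq_nat_or_neg (x i)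
  · rw [hn, hsmul, natCast_zsmul]
    exact nsmul_mem (hgen _ ⟨i, Or.inl rfl⟩) n
  · rw [hn, hsmul, neg_smul, natCast_zsmul, ← smul_neg]
    exact nsmul_mem (hgen _ ⟨i, Or.inr rfl⟩) n

theorem tau_pos (hβ : 0 < β) (x : Fin d → ℤ) : 0 < tau d β x := by
  have hx : x ∈ AddSubmonoid.closure {s : Fin d → ℤ | IsUnitStep s} :=
    closure_isUnitStep d ▸ AddSubmonoid.mem_top x
  induction hx using AddSubmonoid.closure_induction with
  | mem s hs => exact (tanh_pos hβ).trans_le (tanh_le_tau hβ.le hs)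
  | zero => exact (tau_zero hβ.le).symm ▸ one_pos
  | add a b _ _ ha hb => exact (mul_pos ha hb).trans_le (tau_mul_le hβ.le a b)

/-- The projection `π : ℤ^d → 𝕋_r` as a homomorphism. -/
def projHom (d r : ℕ) : (Fin d → ℤ) →+ (Fin d → ZMod r) :=
  ((Int.castRingHom (ZMod r)).compLeft (Fin d) : (Fin d → ℤ) →+* (Fin d → ZMod r))

theorem reduceHom_projHom {r M : ℕ} (h : r ∣ M) (x : Fin d → ℤ) :
    reduceHom d h (projHom d M x) = projHom d r x :=
  funext fun i => map_intCast (ZMod.castHom h (ZMod r)) (x i)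

theorem projHom_surjective (d r : ℕ) : Function.Surjective (projHom d r) := by
  intro v
  choose w hw using fun i => ZMod.intCast_surjective (v i)
  exact ⟨w, funext hw⟩

theorem equivalent_iff {r : ℕ} {x x' : Fin d → ℤ} :
    Equivalent r x' x ↔ projHom d r x' = projHom d r x := by
  have hdvd : Equivalent r x' x ↔ ∀ i, (r : ℤ) ∣ x' i - x i := by
    simp only [Equivalent, funext_iff, Dvd.dvd, Classical.skolem]
    rfl
  rw [hdvd, eq_comm, funext_iff]
  exact forall_congr' fun i => (ZMod.intCast_eq_intCast_iff_dvd_sub (x i) (x' i) r).symm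

theorem projHom_injOn_box (M : ℕ) : Set.InjOn (projHom d M) (box d M) := by
  intro x hx y hy h
  ext i
  have hdvd : (M : ℤ) ∣ y i - x i := (ZMod.intCast_eq_intCast_iff_dvd_sub _ _ _).1 (congrFun h i)
  obtain ⟨hxlo, hxhi⟩ := mem_box.1 hx i
  obtain ⟨hylo, hyhi⟩ := mem_box.1 hy i
  have habs : |(y i : ℝ) - x i| < M := abs_lt.2 ⟨by linarith, by linarith⟩
  have hzero := Int.eq_zero_of_abs_lt_dvd hdvd (by exact_mod_cast habs)
  exact (sub_eq_zero.1 hzero).symm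

/-- The box `Λ_L` as a set of vertices of the torus `𝕋_M`. -/
def boxEmbedding {L M : ℕ} (h : L ≤ M) : box d L ↪ (Fin d → ZMod M) where
  toFun v := projHom d M v.1
  inj' v w hvw := Subtype.ext (projHom_injOn_box M (box_mono h v.2) (box_mono h w.2) hvw)

theorem boxEmbedding_apply {L M : ℕ} (h : L ≤ M) (v : box d L) :
    boxEmbedding h v = projHom d M v.1 := rfl

theorem boxTwoPoint_le_torusTau (hβ : 0 ≤ β) {M : ℕ} [NeZero M] [Fact (1 < M)] (x : Fin d → ℤ) :
    boxTwoPoint d M β 0 x ≤ torusTau d M β (projHom d M x) := by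
  by_cases h : 0 ∈ box d M ∧ x ∈ box d M
  · rw [boxTwoPoint_of_mem h.1 h.2, torusTau, ← map_zero (projHom d M)]
    refine twoPoint_le_of_le_comap hβ (ι := boxEmbedding le_rfl) (fun v w hvw => ?_)
      ⟨0, h.1⟩ ⟨x, h.2⟩
    rw [SimpleGraph.comap_adj, nnGraph_adj, boxEmbedding_apply, boxEmbedding_apply, ← map_sub]
    exact (boxGraph_adj.1 hvw).map (Int.castRingHom (ZMod M))
  · rw [boxTwoPoint_of_notMem h]
    exact twoPoint_nonneg hβ _ _ _

theorem exists_boxGraph_adj {L M : ℕ} [Fact (1 < M)] (hM : L + 2 ≤ M) {a : box d (L + 2)}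
    (ha : a.1 ∈ box d L) {w : Fin d → ZMod M}
    (h : (nnGraph (ZMod M) d).Adj (boxEmbedding hM a) w) :
    ∃ a', boxEmbedding hM a' = w ∧ (boxGraph d (L + 2)).Adj a a' := by
  obtain ⟨s, hs, hsw⟩ := (nnGraph_adj.1 h).exists_map_eq (Int.castRingHom (ZMod M))
  refine ⟨⟨a.1 + s, add_mem_box ha hs⟩, ?_, boxGraph_adj.2 (by simpa using hs)⟩
  rw [boxEmbedding_apply, map_add]
  exact add_eq_of_eq_sub' hsw

theorem torusTau_le_sum_box (hβ : 0 ≤ β) {L M : ℕ} [NeZero M] (hL : 1 ≤ L) (hM : L + 2 ≤ M)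
    (b : Fin d → ZMod M) :
    torusTau d M β b ≤ ∑ a ∈ box d L with projHom d M a = b, boxTwoPoint d (L + 2) β 0 a
      + ∑ y ∈ box d (L + 2) \ box d L,
        boxTwoPoint d (L + 2) β 0 y * torusTau d M β (b - projHom d M y) := by
  have : Fact (1 < M) := ⟨by omega⟩
  have hsub : box d L ⊆ box d (L + 2) := box_mono (Nat.le_add_right L 2)
  have hzero : (0 : Fin d → ℤ) ∈ box d (L + 2) := hsub (zero_mem_box hL)
  let U : Finset (box d (L + 2)) := (box d L).subtype (· ∈ box d (L + 2))
  have hsimon := twoPoint_le_of_embedded hβ (nnGraph (ZMod M) d) (boxGraph d (L + 2))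
    (boxEmbedding hM) U (fun a ha w => exists_boxGraph_adj hM (Finset.mem_subtype.1 ha))
    (o := ⟨0, hzero⟩) (Finset.mem_subtype.2 (zero_mem_box hL)) b
  have hinside : ∑ a with a ∈ U ∧ boxEmbedding hM a = b,
      twoPoint (boxGraph d (L + 2)) β ⟨0, hzero⟩ a
        = ∑ a ∈ box d L with projHom d M a = b, boxTwoPoint d (L + 2) β 0 a := by
    refine Finset.sum_nbij Subtype.val (fun a ha => ?_) Subtype.val_injective.injOn
      (fun a ha => ?_) fun a _ => (boxTwoPoint_of_mem hzero a.2).symm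
    · simpa [U, boxEmbedding_apply] using ha
    · have hmem := hsub (Finset.mem_filter.1 ha).1
      simpa [U, boxEmbedding_apply, hmem] using ha
  have hboundary : ∑ y ∈ Uᶜ, twoPoint (boxGraph d (L + 2)) β ⟨0, hzero⟩ y
        * twoPoint (nnGraph (ZMod M) d) β (boxEmbedding hM y) b
        = ∑ y ∈ box d (L + 2) \ box d L,
          boxTwoPoint d (L + 2) β 0 y * torusTau d M β (b - projHom d M y) := by
    refine Finset.sum_nbij Subtype.val (fun y hy => ?_) Subtype.val_injective.injOn
      (fun y hy => ?_) fun y _ => ?_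
    · simpa [U] using hy
    · simpa [U, and_comm] using hy
    · rw [boxTwoPoint_of_mem hzero y.2, twoPoint_comm (nnGraph _ d), twoPoint_eq_torusTau hβ,
        boxEmbedding_apply]
  rw [hinside, hboundary] at hsimon
  simpa [boxEmbedding_apply, torusTau] using hsimon

theorem torusTau_le_add (hβ : 0 ≤ β) {L M : ℕ} [NeZero M] (hL : 1 ≤ L) (hM : L + 2 ≤ M)
    (b : Fin d → ZMod M) :
    torusTau d M β b ≤ ∑ a ∈ box d L with projHom d M a = b, tau d β a
      + ∑ y ∈ box d (L + 2) \ box d L, tau d β y * torusTau d M β (b - projHom d M y) := by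
  refine (torusTau_le_sum_box hβ hL hM b).trans ?_
  gcongr with a _ y _
  exacts [boxTwoPoint_le_tau hβ _ a, twoPoint_nonneg hβ _ _ _, boxTwoPoint_le_tau hβ _ y]

end InfiniteVolume

/-! ### Rearrangement of the error term -/

section Rearrangement

variable {A B C : Type*}

/-- The push-forward of a weight `f` along a map `q`. -/
def pushforward (q : A → B) (f : A → ℝ≥0∞) (b : B) : ℝ≥0∞ :=
  ∑' a : {a // q a = b}, f a

/-- The sum of `f a * f b` over the ordered pairs `(a, b)` with `R a b`. -/
def pairSum (f : A → ℝ≥0∞) (R : A → A → Prop) : ℝ≥0∞ :=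
  ∑' ab : {ab : A × A // R ab.1 ab.2}, f ab.1.1 * f ab.1.2

/-- The right-hand side of the comparison of two-point functions, for weights `f` on a group and `g`
on its image under `p`; the theorem uses `p = π`, `f = τ` and `g = τ^𝕋`. -/
def errorSum [AddCommGroup A] [AddCommGroup C] (p : A →+ C) (f : A → ℝ≥0∞) (g : C → ℝ≥0∞) (x : C) :
    ℝ≥0∞ :=
  ∑' x' : {x' // p x' = x}, ∑' y, ∑' y' : {y' // p y' = p y ∧ y' ≠ y}, ∑' z,
    f z * f (y - z) * f (y' - z) * g (p y' - p z) * f (x' - y)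

theorem tsum_subtype_pushforward (q : A → B) (f : A → ℝ≥0∞) (P : B → Prop) :
    ∑' b : {b // P b}, pushforward q f b = ∑' a : {a // P (q a)}, f a := by
  simp only [pushforward]
  rw [← ENNReal.tsum_sigma' fun s : Σ b : {b // P b}, {a // q a = b} => f s.2]
  exact (Equiv.sigmaSubtypeFiberEquivSubtype q fun _ => Iff.rfl).tsum_eq
    fun a : {a // P (q a)} => f a

theorem tsum_pushforward (q : A → B) (f : A → ℝ≥0∞) : ∑' b, pushforward q f b = ∑' a, f a :=
  ENNReal.tsum_fiberwise f q

theorem sum_le_pushforward {q : A → B} (f : A → ℝ≥0∞) {b : B} {s : Finset A}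
    (hs : ∀ a ∈ s, q a = b) : ∑ a ∈ s, f a ≤ pushforward q f b := by
  rw [← Finset.tsum_subtype]
  exact ENNReal.tsum_mono_subtype f hs

theorem pushforward_le_of_sum_le {q : A → B} {f : A → ℝ≥0∞} {b : B} {c : ℝ≥0∞}
    (h : ∀ s : Finset A, (∀ a ∈ s, q a = b) → ∑ a ∈ s, f a ≤ c) : pushforward q f b ≤ c := by
  rw [pushforward, ENNReal.tsum_eq_iSup_sum]
  refine iSup_le fun s => ?_
  simpa using h (s.map (Function.Embedding.subtype _)) (by simp +contextual)

theorem pushforward_le_of_le_add (q : A → B) {f h ρ : A → ℝ≥0∞} (hh : ∀ a, h a ≤ f a + ρ a)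
    (b : B) : pushforward q h b ≤ pushforward q f b + ∑' a, ρ a := by
  refine (ENNReal.tsum_le_tsum fun a : {a // q a = b} => hh a).trans (ENNReal.tsum_add.trans_le ?_)
  exact add_le_add_right (ENNReal.tsum_comp_le_tsum_of_injective Subtype.val_injective ρ) _

theorem pushforward_comp (q : A → B) (p : B → C) (f : A → ℝ≥0∞) (c : C) :
    pushforward p (pushforward q f) c = pushforward (p ∘ q) f c :=
  tsum_subtype_pushforward q f (p · = c)

theorem tsum_prod_mul (f : A → ℝ≥0∞) (h : B → ℝ≥0∞) :
    ∑' s : A × B, f s.1 * h s.2 = (∑' a, f a) * ∑' b, h b := by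
  simp only [ENNReal.tsum_prod', ENNReal.tsum_mul_left, ENNReal.tsum_mul_right]

theorem pushforward_prodMap (q : A → B) (f : A → ℝ≥0∞) (b b' : B) :
    pushforward (Prod.map q q) (fun a => f a.1 * f a.2) (b, b')
      = pushforward q f b * pushforward q f b' := by
  rw [pushforward, pushforward, pushforward, ← tsum_prod_mul]
  have hmap : ∀ s, Prod.map q q s = (b, b') ↔ q s.1 = b ∧ q s.2 = b' := fun _ => Prod.ext_iff
  let e : {s // Prod.map q q s = (b, b')} ≃ {a // q a = b} × {a // q a = b'} :=
    (Equiv.subtypeEquivRight hmap).trans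
      (Equiv.subtypeProdEquivProd (p := (q · = b)) (q := (q · = b')))
  exact e.tsum_eq fun s => f s.1 * f s.2

theorem pairSum_pushforward (q : A → B) (f : A → ℝ≥0∞) (R : B → B → Prop) :
    pairSum (pushforward q f) R = pairSum f fun a a' => R (q a) (q a') := by
  simp only [pairSum, ← pushforward_prodMap]
  exact tsum_subtype_pushforward (Prod.map q q) (fun a => f a.1 * f a.2) fun b => R b.1 b.2

theorem pairSum_eq_tsum_tsum (f : A → ℝ≥0∞) (R : A → A → Prop) :
    pairSum f R = ∑' a, ∑' b : {b // R a b}, f a * f b := by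
  rw [← ENNReal.tsum_sigma' fun s : Σ a, {b // R a b} => f s.1 * f s.2]
  exact (Equiv.subtypeProdEquivSigmaSubtype R).tsum_eq fun s => f s.1 * f s.2

theorem pairSum_mono_right (f : A → ℝ≥0∞) {R R' : A → A → Prop} (hR : ∀ a b, R a b → R' a b) :
    pairSum f R ≤ pairSum f R' :=
  ENNReal.tsum_mono_subtype (fun ab : A × A => f ab.1 * f ab.2) fun ab => hR ab.1 ab.2

theorem pairSum_mono_left {f f' : A → ℝ≥0∞} (hf : ∀ a, f a ≤ f' a) (R : A → A → Prop) :
    pairSum f R ≤ pairSum f' R :=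
  ENNReal.tsum_le_tsum fun _ => mul_le_mul' (hf _) (hf _)

theorem pairSum_le (f : A → ℝ≥0∞) (R : A → A → Prop) :
    pairSum f R ≤ (∑' a, f a) * ∑' a, f a :=
  (ENNReal.tsum_comp_le_tsum_of_injective Subtype.val_injective _).trans_eq (tsum_prod_mul f f)

theorem pairSum_add_le (f h : A → ℝ≥0∞) (R : A → A → Prop) :
    pairSum (fun a => f a + h a) R
      ≤ pairSum f R + (∑' a, h a) * (2 * (∑' a, f a) + ∑' a, h a) := by
  have hcross : (∑' a, h a) * (2 * (∑' a, f a) + ∑' a, h a)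
      = ∑' ab : A × A, (f ab.1 * h ab.2 + h ab.1 * f ab.2 + h ab.1 * h ab.2) := by
    simp only [ENNReal.tsum_add, tsum_prod_mul]
    ring
  calc pairSum (fun a => f a + h a) R
      = ∑' ab : {ab : A × A // R ab.1 ab.2}, (f ab.1.1 * f ab.1.2
        + (f ab.1.1 * h ab.1.2 + h ab.1.1 * f ab.1.2 + h ab.1.1 * h ab.1.2)) :=
        tsum_congr fun ab => by ring
    _ ≤ pairSum f R + (∑' a, h a) * (2 * (∑' a, f a) + ∑' a, h a) := by
        rw [ENNReal.tsum_add, hcross]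
        exact add_le_add_right
          (ENNReal.tsum_comp_le_tsum_of_injective Subtype.val_injective _) _

theorem tsum_mul_pairSum (k : A → C) (f : A → ℝ≥0∞) (R : A → A → Prop) (F : C → ℝ≥0∞) :
    ∑' v, F v * pairSum f (fun a b => k a = v ∧ R a b)
      = ∑' a, F (k a) * ∑' b : {b // R a b}, f a * f b := by
  simp only [pairSum_eq_tsum_tsum, ← ENNReal.tsum_mul_left]
  rw [ENNReal.tsum_comm]
  refine tsum_congr fun a => ?_
  rw [tsum_eq_single (k a)]
  · exact (Equiv.subtypeEquivRight fun b => and_iff_right rfl).tsum_eq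
      fun b : {b // R a b} => F (k a) * (f a * f b)
  · intro v hv
    have : IsEmpty {b // k a = v ∧ R a b} := ⟨fun b => hv b.2.1.symm⟩
    exact tsum_empty

variable [AddCommGroup A] [AddCommGroup B] [AddCommGroup C]

theorem errorSum_eq_tsum (p : A →+ C) (f : A → ℝ≥0∞) (g : C → ℝ≥0∞) (x : C) :
    errorSum p f g x = ∑' a, g (p a) * pairSum f (fun z c => p z + p c = x - p a)
      * ∑' b : {b // p b = p a ∧ b ≠ a}, f a * f b := by
  calc errorSum p f g x
      = ∑' x' : {x' // p x' = x}, ∑' z, ∑' y, ∑' y' : {y' // p y' = p y ∧ y' ≠ y},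
          f z * f (y - z) * f (y' - z) * g (p y' - p z) * f (x' - y) := by
        refine tsum_congr fun x' => ?_
        rw [ENNReal.tsum_comm]
        exact tsum_congr fun y => ENNReal.tsum_comm
    _ = ∑' x' : {x' // p x' = x}, ∑' z, ∑' a, ∑' b : {b // p b = p a ∧ b ≠ a},
          f z * f a * f b * g (p a) * f (x' - (z + a)) := by
        refine tsum_congr fun x' => tsum_congr fun z => ?_
        rw [← (Equiv.addLeft z).tsum_eq]
        refine tsum_congr fun a => ?_
        have hb : ∀ b, p b = p a ∧ b ≠ a ↔ p (z + b) = p (z + a) ∧ z + b ≠ z + a := by simp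
        rw [← ((Equiv.addLeft z).subtypeEquiv hb).tsum_eq]
        refine tsum_congr fun b => ?_
        change f z * f (z + a - z) * f (z + b - z) * g (p (z + b) - p z) * f (x' - (z + a)) = _
        simp [b.2.1]
    _ = ∑' a, ∑' z, ∑' x' : {x' // p x' = x}, ∑' b : {b // p b = p a ∧ b ≠ a},
          f z * f a * f b * g (p a) * f (x' - (z + a)) := by
        rw [ENNReal.tsum_comm, tsum_congr fun z => ENNReal.tsum_comm, ENNReal.tsum_comm]
    _ = ∑' a, ∑' z, ∑' c : {c // p z + p c = x - p a}, ∑' b : {b // p b = p a ∧ b ≠ a},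
          f z * f a * f b * g (p a) * f c := by
        refine tsum_congr fun a => tsum_congr fun z => ?_
        have hc : ∀ c, p z + p c = x - p a ↔ p (z + a + c) = x := fun c => by
          rw [eq_sub_iff_add_eq, map_add, map_add, add_right_comm]
        rw [← ((Equiv.addLeft (z + a)).subtypeEquiv hc).tsum_eq]
        simp
    _ = ∑' a, g (p a) * pairSum f (fun z c => p z + p c = x - p a)
          * ∑' b : {b // p b = p a ∧ b ≠ a}, f a * f b := by
        have hfactor : ∀ a b c z, f z * f a * f b * g (p a) * f c
            = g (p a) * (f z * f c) * (f a * f b) := fun a b c z => by ring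
        simp only [hfactor, ENNReal.tsum_mul_left, ENNReal.tsum_mul_right, pairSum_eq_tsum_tsum]

theorem errorSum_eq (p : A →+ C) (f : A → ℝ≥0∞) (g : C → ℝ≥0∞) (x : C) :
    errorSum p f g x = ∑' v, g v * pairSum f (fun z c => p z + p c = x - v)
      * pairSum f fun a b => p a = v ∧ p b = p a ∧ b ≠ a :=
  (errorSum_eq_tsum p f g x).trans (tsum_mul_pairSum p f (fun a b => p b = p a ∧ b ≠ a)
    fun v => g v * pairSum f fun z c => p z + p c = x - v).symm

theorem errorSum_le_of_le_pushforward (q : A →+ B) (p : B →+ C) (f : A → ℝ≥0∞) (h ρ : B → ℝ≥0∞)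
    (hh : ∀ b, h b ≤ pushforward q f b + ρ b) (g : C → ℝ≥0∞) (x : C) {δ : ℝ≥0∞}
    (hδ : (∑' b, ρ b) * (2 * (∑' a, f a) + ∑' b, ρ b) ≤ δ) :
    errorSum p h g x ≤ ∑' v, g v * (pairSum f (fun a b => p (q a) + p (q b) = x - v) + δ)
      * (pairSum f (fun a b => p (q a) = v ∧ p (q b) = p (q a) ∧ b ≠ a) + δ) := by
  have hpair : ∀ R : B → B → Prop, pairSum h R ≤ pairSum f (fun a b => R (q a) (q b)) + δ := by
    intro R
    refine (pairSum_mono_left hh R).trans ((pairSum_add_le _ _ R).trans ?_)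
    rw [pairSum_pushforward, tsum_pushforward]
    exact add_le_add le_rfl hδ
  rw [errorSum_eq]
  gcongr with v
  · exact hpair _
  · refine (hpair _).trans (add_le_add_left (pairSum_mono_right f ?_) δ)
    exact fun a b ⟨ha, hab, hne⟩ => ⟨ha, hab, fun h => hne (congrArg q h)⟩

end Rearrangement

/-! ### The limit of large tori -/

section Limit

variable {d : ℕ} {β : ℝ}

/-- The susceptibility `χ = ∑_x τ_β(x)`, with values in `[0, ∞]`. -/
def susceptibility (d : ℕ) (β : ℝ) : ℝ≥0∞ :=
  ∑' x, ENNReal.ofReal (tau d β x)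

theorem exists_ne_zero_le_mul_le {c u ε : ℝ≥0∞} (hc : c ≠ ∞) (hu : u ≠ 0) (hε : ε ≠ 0) :
    ∃ η ≠ 0, η ≤ u ∧ η * c ≤ ε :=
  ⟨min u (ε / c), (lt_min hu.bot_lt (ENNReal.div_pos hε hc)).ne', min_le_left _ _,
    ENNReal.mul_le_of_le_div (min_le_right _ _)⟩

theorem le_two_mul_of_le_add_mul {H χ φ : ℝ≥0∞} (hH : H ≠ ∞) (hφ : φ ≤ 2⁻¹)
    (h : H ≤ χ + φ * H) : H ≤ 2 * χ := by
  have hadd : H / 2 + H / 2 ≤ χ + H / 2 := by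
    rw [ENNReal.add_halves, div_eq_mul_inv, mul_comm H]
    exact h.trans (by gcongr)
  have hhalf : H / 2 ≤ χ := by
    rwa [ENNReal.add_le_add_iff_right (ENNReal.div_ne_top hH two_ne_zero)] at hadd
  calc H = 2 * (H / 2) := by rw [two_mul, ENNReal.add_halves]
    _ ≤ 2 * χ := by gcongr

theorem tsum_sum_mul_sub {A B : Type*} [AddGroup B] (k : A → B) (f : A → ℝ≥0∞) (h : B → ℝ≥0∞)
    (s : Finset A) : ∑' b, ∑ y ∈ s, f y * h (b - k y) = (∑ y ∈ s, f y) * ∑' b, h b := by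
  rw [Summable.tsum_finsetSum fun _ _ => ENNReal.summable, Finset.sum_mul]
  refine Finset.sum_congr rfl fun y _ => ?_
  rw [ENNReal.tsum_mul_left]
  exact congrArg (f y * ·) ((Equiv.subRight (k y)).tsum_eq h)

theorem exists_sum_sdiff_box_le {f : (Fin d → ℤ) → ℝ≥0∞} (hf : ∑' x, f x ≠ ∞) {η : ℝ≥0∞}
    (hη : η ≠ 0) : ∃ L, 1 ≤ L ∧ ∑ y ∈ box d (L + 2) \ box d L, f y ≤ η := by
  have htail := (ENNReal.tendsto_tsum_compl_atTop_zero hf).eventually_le_const hη.bot_lt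
  obtain ⟨s, hs⟩ := eventually_atTop.1 htail
  obtain ⟨L, hsL, hL⟩ := ((eventually_subset_box s).and (eventually_ge_atTop 1)).exists
  refine ⟨L, hL, le_trans ?_ (hs _ hsL)⟩
  rw [← Finset.tsum_subtype]
  exact ENNReal.tsum_mono_subtype f fun x hx => (Finset.mem_sdiff.1 hx).2

theorem torusTau_nonneg (hβ : 0 ≤ β) {r : ℕ} [NeZero r] (x : Fin d → ZMod r) :
    0 ≤ torusTau d r β x := twoPoint_nonneg hβ _ _ _

theorem ofReal_torusTau_le_add (hβ : 0 ≤ β) {L M : ℕ} [NeZero M] (hL : 1 ≤ L) (hM : L + 2 ≤ M)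
    (b : Fin d → ZMod M) :
    ENNReal.ofReal (torusTau d M β b) ≤ pushforward (projHom d M) (ENNReal.ofReal ∘ tau d β) b
      + ∑ y ∈ box d (L + 2) \ box d L, ENNReal.ofReal (tau d β y)
        * ENNReal.ofReal (torusTau d M β (b - projHom d M y)) := by
  refine (ENNReal.ofReal_le_ofReal (torusTau_le_add hβ hL hM b)).trans
    (ENNReal.ofReal_add_le.trans (add_le_add ?_ ?_))
  · rw [ENNReal.ofReal_sum_of_nonneg fun a _ => tau_nonneg hβ a]
    exact sum_le_pushforward (ENNReal.ofReal ∘ tau d β) fun a ha => (Finset.mem_filter.1 ha).2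
  · rw [ENNReal.ofReal_sum_of_nonneg
      fun y _ => mul_nonneg (tau_nonneg hβ y) (torusTau_nonneg hβ _)]
    exact Finset.sum_le_sum fun y _ => (ENNReal.ofReal_mul (tau_nonneg hβ y)).le

theorem exists_torusTau_le_pushforward (hβ : 0 ≤ β) (hχ : susceptibility d β ≠ ∞) {ε : ℝ≥0∞}
    (hε : ε ≠ 0) :
    ∃ M₀ : ℕ, ∀ (M : ℕ) [NeZero M], M₀ ≤ M → ∃ ρ : (Fin d → ZMod M) → ℝ≥0∞, ∑' b, ρ b ≤ ε ∧
      ∀ b, ENNReal.ofReal (torusTau d M β b)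
        ≤ pushforward (projHom d M) (ENNReal.ofReal ∘ tau d β) b + ρ b := by
  have htwo : 2 * susceptibility d β ≠ ∞ := ENNReal.mul_ne_top ENNReal.ofNat_ne_top hχ
  obtain ⟨η, hη, hηhalf, hηε⟩ :=
    exists_ne_zero_le_mul_le (u := 2⁻¹) htwo (ENNReal.inv_ne_zero.2 ENNReal.ofNat_ne_top) hε
  obtain ⟨L, hL, hφ⟩ := exists_sum_sdiff_box_le hχ hη
  refine ⟨L + 2, fun M _ hM => ⟨_, ?_, ofReal_torusTau_le_add hβ hL hM⟩⟩
  have hshift := tsum_sum_mul_sub (projHom d M) (ENNReal.ofReal ∘ tau d β)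
    (ENNReal.ofReal ∘ torusTau d M β) (box d (L + 2) \ box d L)
  simp only [Function.comp_apply] at hshift
  rw [hshift]
  have hfinite : ∑' b, ENNReal.ofReal (torusTau d M β b) ≠ ∞ := by
    rw [tsum_fintype]
    exact ENNReal.sum_ne_top.2 fun b _ => ENNReal.ofReal_ne_top
  have htotal := ENNReal.tsum_le_tsum (ofReal_torusTau_le_add (d := d) hβ hL hM)
  rw [ENNReal.tsum_add, tsum_pushforward,
    hshift] at htotal
  exact (mul_le_mul' hφ (le_two_mul_of_le_add_mul hfinite (hφ.trans hηhalf) htotal)).trans hηε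

section Finite

variable {A C : Type*} [Fintype A]

theorem tsum_subtype_eq_sum_filter (P : A → Prop) [DecidablePred P] (F : A → ℝ≥0∞) :
    ∑' a : {a // P a}, F a = ∑ a with P a, F a := by
  rw [tsum_fintype, ← Finset.sum_subtype (Finset.univ.filter P) (by simp)]

theorem pushforward_ofReal [DecidableEq C] (q : A → C) {f : A → ℝ} (hf : ∀ a, 0 ≤ f a) (c : C) :
    pushforward q (ENNReal.ofReal ∘ f) c = ENNReal.ofReal (∑ a with q a = c, f a) := by
  rw [ENNReal.ofReal_sum_of_nonneg fun a _ => hf a]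
  exact tsum_subtype_eq_sum_filter _ _

theorem errorSum_ofReal [AddCommGroup A] [AddCommGroup C] [DecidableEq A] [DecidableEq C]
    (p : A →+ C) {f : A → ℝ} (hf : ∀ a, 0 ≤ f a) {g : C → ℝ} (hg : ∀ c, 0 ≤ g c) (x : C) :
    errorSum p (ENNReal.ofReal ∘ f) (ENNReal.ofReal ∘ g) x
      = ENNReal.ofReal (∑ x' with p x' = x, ∑ y, ∑ y' with p y' = p y ∧ y' ≠ y, ∑ z,
        f z * f (y - z) * f (y' - z) * g (p y' - p z) * f (x' - y)) := by
  lift f to A → NNReal using hf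
  lift g to C → NNReal using hg
  simp only [← NNReal.coe_mul, ← NNReal.coe_sum, ENNReal.ofReal_coe_nnreal,
    ENNReal.ofNNReal_finsetSum, ENNReal.coe_mul, ← tsum_subtype_eq_sum_filter]
  simp only [errorSum, Function.comp_apply, ENNReal.ofReal_coe_nnreal, tsum_fintype]

end Finite

theorem ofReal_torusTau_le_pushforward_reduceHom (hβ : 0 ≤ β) {r M : ℕ} [NeZero r] [NeZero M]
    [Fact (2 < r)] (h : r ∣ M) (x : Fin d → ZMod r) :
    ENNReal.ofReal (torusTau d r β x)
      ≤ pushforward (reduceHom d h) (ENNReal.ofReal ∘ torusTau d M β) x := by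
  rw [pushforward_ofReal _ (torusTau_nonneg hβ)]
  exact ENNReal.ofReal_le_ofReal (torusTau_le_sum_fiber hβ h x)

theorem pushforward_reduceHom_le_add_errorSum (hβ : 0 ≤ β) {r M : ℕ} [NeZero r] [NeZero M]
    [Fact (2 < r)] (h : r ∣ M) (x : Fin d → ZMod r) :
    pushforward (reduceHom d h) (ENNReal.ofReal ∘ torusTau d M β) x
      ≤ ENNReal.ofReal (torusTau d r β x) + errorSum (reduceHom d h)
        (ENNReal.ofReal ∘ torusTau d M β) (ENNReal.ofReal ∘ torusTau d r β) x := by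
  rw [pushforward_ofReal _ (torusTau_nonneg hβ),
    errorSum_ofReal _ (torusTau_nonneg hβ) (torusTau_nonneg hβ)]
  exact (ENNReal.ofReal_le_ofReal (sum_fiber_torusTau_le hβ h x)).trans ENNReal.ofReal_add_le

theorem sum_boxTwoPoint_le_pushforward (hβ : 0 ≤ β) {r M : ℕ} [NeZero M] [Fact (1 < M)] (h : r ∣ M)
    {s : Finset (Fin d → ℤ)} (hs : s ⊆ box d M) {x : Fin d → ZMod r}
    (hx : ∀ a ∈ s, projHom d r a = x) :
    ∑ a ∈ s, ENNReal.ofReal (boxTwoPoint d M β 0 a)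
      ≤ pushforward (reduceHom d h) (ENNReal.ofReal ∘ torusTau d M β) x := by
  calc ∑ a ∈ s, ENNReal.ofReal (boxTwoPoint d M β 0 a)
      ≤ ∑ a ∈ s, ENNReal.ofReal (torusTau d M β (projHom d M a)) := by
        gcongr with a
        exact boxTwoPoint_le_torusTau hβ a
    _ = ∑ b ∈ s.image (projHom d M), ENNReal.ofReal (torusTau d M β b) :=
        (Finset.sum_image (f := fun b => ENNReal.ofReal (torusTau d M β b))
          ((projHom_injOn_box M).mono hs)).symm
    _ ≤ pushforward (reduceHom d h) (ENNReal.ofReal ∘ torusTau d M β) x := by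
        refine sum_le_pushforward (ENNReal.ofReal ∘ torusTau d M β) fun b hb => ?_
        obtain ⟨a, ha, rfl⟩ := Finset.mem_image.1 hb
        rw [reduceHom_projHom, hx a ha]

theorem pushforward_tau_le_of_forall_torus (hβ : 0 ≤ β) {r : ℕ} [NeZero r] {x : Fin d → ZMod r}
    {c : ℝ≥0∞} (M₀ : ℕ) (hc : ∀ (M : ℕ) [NeZero M] (h : r ∣ M), M₀ ≤ M →
      pushforward (reduceHom d h) (ENNReal.ofReal ∘ torusTau d M β) x ≤ c) :
    pushforward (projHom d r) (ENNReal.ofReal ∘ tau d β) x ≤ c := by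
  refine pushforward_le_of_sum_le fun s hs => ?_
  have hM : Tendsto (fun N : ℕ => N * r) atTop atTop := tendsto_id.atTop_mul_const' (NeZero.pos r)
  have hlim : Tendsto (fun N : ℕ => ∑ a ∈ s, ENNReal.ofReal (boxTwoPoint d (N * r) β 0 a)) atTop
      (nhds (∑ a ∈ s, ENNReal.ofReal (tau d β a))) :=
    tendsto_finsetSum s fun a _ => ENNReal.tendsto_ofReal ((tendsto_boxTwoPoint hβ a).comp hM)
  refine le_of_tendsto hlim ?_
  filter_upwards [hM.eventually (eventually_subset_box s), hM.eventually_ge_atTop (max M₀ 2)]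
    with N hsN hN
  have : NeZero (N * r) := ⟨by omega⟩
  have : Fact (1 < N * r) := ⟨by omega⟩
  exact (sum_boxTwoPoint_le_pushforward hβ (Dvd.intro_left N rfl) hsN hs).trans
    (hc _ _ (le_of_max_le_left hN))

theorem ofReal_torusTau_le_pushforward (hβ : 0 ≤ β) {r : ℕ} [NeZero r] [Fact (2 < r)]
    (hχ : susceptibility d β ≠ ∞) (x : Fin d → ZMod r) :
    ENNReal.ofReal (torusTau d r β x)
      ≤ pushforward (projHom d r) (ENNReal.ofReal ∘ tau d β) x := by
  refine ENNReal.le_of_forall_pos_le_add fun ε hε _ => ?_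
  obtain ⟨M₀, hM₀⟩ := exists_torusTau_le_pushforward hβ hχ (ENNReal.coe_ne_zero.2 hε.ne')
  have : NeZero ((M₀ + 1) * r) := ⟨mul_ne_zero (Nat.succ_ne_zero _) (NeZero.ne r)⟩
  have hdvd : r ∣ (M₀ + 1) * r := Dvd.intro_left _ rfl
  obtain ⟨ρ, hρ, hle⟩ := hM₀ ((M₀ + 1) * r)
    ((Nat.le_succ M₀).trans (Nat.le_mul_of_pos_right _ (NeZero.pos r)))
  have hcomp : reduceHom d hdvd ∘ projHom d ((M₀ + 1) * r) = projHom d r :=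
    funext (reduceHom_projHom hdvd)
  calc ENNReal.ofReal (torusTau d r β x)
      ≤ pushforward (reduceHom d hdvd) (ENNReal.ofReal ∘ torusTau d ((M₀ + 1) * r) β) x :=
        ofReal_torusTau_le_pushforward_reduceHom hβ hdvd x
    _ ≤ pushforward (reduceHom d hdvd) (pushforward (projHom d ((M₀ + 1) * r))
          (ENNReal.ofReal ∘ tau d β)) x + ∑' b, ρ b := pushforward_le_of_le_add _ hle x
    _ ≤ pushforward (projHom d r) (ENNReal.ofReal ∘ tau d β) x + ε := by
        rw [pushforward_comp, hcomp]
        gcongr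

theorem pushforward_le_add_of_ne_zero (hβ : 0 ≤ β) {r : ℕ} [NeZero r] [Fact (2 < r)]
    (hχ : susceptibility d β ≠ ∞) (x : Fin d → ZMod r) {δ : ℝ≥0∞} (hδ : δ ≠ 0) :
    pushforward (projHom d r) (ENNReal.ofReal ∘ tau d β) x
      ≤ ENNReal.ofReal (torusTau d r β x) + ∑' v, ENNReal.ofReal (torusTau d r β v)
        * (pairSum (ENNReal.ofReal ∘ tau d β)
            (fun a b => projHom d r a + projHom d r b = x - v) + δ)
        * (pairSum (ENNReal.ofReal ∘ tau d β)
            (fun a b => projHom d r a = v ∧ projHom d r b = projHom d r a ∧ b ≠ a) + δ) := by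
  have hfinite : 2 * susceptibility d β + 1 ≠ ∞ :=
    ENNReal.add_ne_top.2 ⟨ENNReal.mul_ne_top ENNReal.ofNat_ne_top hχ, ENNReal.one_ne_top⟩
  obtain ⟨ε, hε, hε1, hεδ⟩ := exists_ne_zero_le_mul_le hfinite one_ne_zero hδ
  obtain ⟨M₀, hM₀⟩ := exists_torusTau_le_pushforward hβ hχ hε
  refine pushforward_tau_le_of_forall_torus hβ M₀ fun M _ hdvd hM => ?_
  obtain ⟨ρ, hρ, hle⟩ := hM₀ M hM
  refine (pushforward_reduceHom_le_add_errorSum hβ hdvd x).trans (add_le_add_right ?_ _)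
  have hρδ : (∑' b, ρ b) * (2 * susceptibility d β + ∑' b, ρ b) ≤ δ :=
    (mul_le_mul' hρ (add_le_add_right (hρ.trans hε1) _)).trans hεδ
  have herror := errorSum_le_of_le_pushforward (projHom d M) (reduceHom d hdvd)
    (ENNReal.ofReal ∘ tau d β) (ENNReal.ofReal ∘ torusTau d M β) ρ hle
    (ENNReal.ofReal ∘ torusTau d r β) x hρδ
  simp only [reduceHom_projHom] at herror
  exact herror

theorem le_add_tsum_of_forall_ne_zero {C : Type*} [Finite C] {c b : ℝ≥0∞} {g P Q : C → ℝ≥0∞}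
    (hg : ∀ v, g v ≠ ∞) (hP : ∀ v, P v ≠ ∞) (hQ : ∀ v, Q v ≠ ∞)
    (h : ∀ δ ≠ 0, c ≤ b + ∑' v, g v * (P v + δ) * (Q v + δ)) :
    c ≤ b + ∑' v, g v * P v * Q v := by
  cases nonempty_fintype C
  have hid : Tendsto (fun δ : ℝ≥0∞ => δ) (nhdsWithin 0 (Set.Ioi 0)) (nhds 0) :=
    tendsto_id.mono_left nhdsWithin_le_nhds
  have hadd : ∀ a : ℝ≥0∞, Tendsto (fun δ => a + δ) (nhdsWithin 0 (Set.Ioi 0)) (nhds a) :=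
    fun a => by simpa using tendsto_const_nhds.add hid
  have hlim : Tendsto (fun δ : ℝ≥0∞ => b + ∑' v, g v * (P v + δ) * (Q v + δ))
      (nhdsWithin 0 (Set.Ioi 0)) (nhds (b + ∑' v, g v * P v * Q v)) := by
    simp only [tsum_fintype, mul_assoc]
    refine tendsto_const_nhds.add (tendsto_finsetSum _ fun v _ => ?_)
    exact ENNReal.Tendsto.const_mul
      (ENNReal.Tendsto.mul (hadd _) (Or.inr (hQ v)) (hadd _) (Or.inr (hP v))) (Or.inr (hg v))
  refine ge_of_tendsto hlim ?_
  filter_upwards [self_mem_nhdsWithin] with δ hδ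
  exact h δ (ne_of_gt hδ)

theorem pushforward_le_add_errorSum (hβ : 0 ≤ β) {r : ℕ} [NeZero r] [Fact (2 < r)]
    (hχ : susceptibility d β ≠ ∞) (x : Fin d → ZMod r) :
    pushforward (projHom d r) (ENNReal.ofReal ∘ tau d β) x
      ≤ ENNReal.ofReal (torusTau d r β x) + errorSum (projHom d r)
        (ENNReal.ofReal ∘ tau d β) (ENNReal.ofReal ∘ torusTau d r β) x := by
  have hpair : ∀ R, pairSum (ENNReal.ofReal ∘ tau d β) R ≠ ∞ := fun R =>
    ne_top_of_le_ne_top (ENNReal.mul_ne_top hχ hχ) (pairSum_le _ R)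
  rw [errorSum_eq]
  exact le_add_tsum_of_forall_ne_zero (fun v => ENNReal.ofReal_ne_top) (fun v => hpair _)
    (fun v => hpair _) fun δ hδ => pushforward_le_add_of_ne_zero hβ hχ x hδ

end Limit

section Final

variable {d r : ℕ} {β : ℝ}

theorem unfolded_eq_pushforward (hr : r ≠ 0) (x : Fin d → ℤ) : unfolded d r β x
    = pushforward (projHom d r) (ENNReal.ofReal ∘ tau d β) (projHom d r x) := by
  have hfiber : ∀ u : Fin d → ℤ, projHom d r (x + (r : ℤ) • u) = projHom d r x := fun u =>
    equivalent_iff.1 ⟨u, add_sub_cancel_left _ _⟩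
  have hinj : Function.Injective fun u : Fin d → ℤ => x + (r : ℤ) • u :=
    (add_right_injective x).comp (smul_right_injective _ (Int.natCast_ne_zero.2 hr))
  let e : (Fin d → ℤ) ≃ {a // projHom d r a = projHom d r x} :=
    Equiv.ofBijective (fun u => ⟨x + (r : ℤ) • u, hfiber u⟩)
      ⟨fun u v huv => hinj (congrArg Subtype.val huv), fun ⟨a, ha⟩ => by
        obtain ⟨u, hu⟩ := equivalent_iff.2 ha
        exact ⟨u, Subtype.ext ((congrArg (x + ·) hu).symm.trans (add_sub_cancel x a))⟩⟩
  exact e.tsum_eq fun a => ENNReal.ofReal (tau d β a)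

theorem tsum_equivalent_eq_errorSum (f : (Fin d → ℤ) → ℝ≥0∞) (g : (Fin d → ZMod r) → ℝ≥0∞)
    (x : Fin d → ℤ) :
    ∑' x' : {x' // Equivalent r x' x}, ∑' y, ∑' y' : {y' // Equivalent r y' y ∧ y' ≠ y}, ∑' z,
        f z * f (y - z) * f (y'.1 - z) * g (proj d r y'.1 - proj d r z)
          * f (x'.1 - y)
      = errorSum (projHom d r) f g (projHom d r x) := by
  have hequiv : Equivalent (d := d) r = fun x' x => projHom d r x' = projHom d r x :=
    funext fun _ => funext fun _ => propext equivalent_iff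
  rw [hequiv]
  rfl

theorem pushforward_mul_le (hβ : 0 ≤ β) (w x : Fin d → ℤ) :
    pushforward (projHom d r) (ENNReal.ofReal ∘ tau d β) (projHom d r w)
        * ENNReal.ofReal (tau d β (x - w))
      ≤ pushforward (projHom d r) (ENNReal.ofReal ∘ tau d β) (projHom d r x) := by
  let shift : {a // projHom d r a = projHom d r w} → {a // projHom d r a = projHom d r x} :=
    fun a => ⟨a + (x - w), by rw [map_add, map_sub, a.2, add_sub_cancel]⟩
  have hshift : Function.Injective shift := fun a b hab =>
    Subtype.ext (add_right_cancel (congrArg Subtype.val hab))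
  rw [pushforward, ← ENNReal.tsum_mul_right]
  refine le_trans (ENNReal.tsum_le_tsum fun a => ?_)
    (ENNReal.tsum_comp_le_tsum_of_injective hshift fun a => ENNReal.ofReal (tau d β a))
  rw [Function.comp_apply, ← ENNReal.ofReal_mul (tau_nonneg hβ _)]
  exact ENNReal.ofReal_le_ofReal (tau_mul_le hβ _ _)

theorem susceptibility_ne_top (hβ : 0 < β) [NeZero r] {x : Fin d → ℤ}
    (h : pushforward (projHom d r) (ENNReal.ofReal ∘ tau d β) (projHom d r x) ≠ ∞) :
    susceptibility d β ≠ ∞ := by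
  have hsum := tsum_pushforward (projHom d r) (ENNReal.ofReal ∘ tau d β)
  rw [tsum_fintype] at hsum
  refine hsum.symm.trans_ne (ENNReal.sum_ne_top.2 fun v _ htop => h (top_le_iff.1 ?_))
  obtain ⟨w, rfl⟩ := projHom_surjective d r v
  have hle := pushforward_mul_le hβ.le (r := r) w x
  rwa [htop, ENNReal.top_mul (ENNReal.ofReal_pos.2 (tau_pos hβ _)).ne'] at hle

theorem mul_pushforward_le_errorSum {A C : Type*} [AddCommGroup A] [AddCommGroup C] (p : A →+ C)
    {f : A → ℝ≥0∞} {g : C → ℝ≥0∞} (hf : f 0 = 1) (hg : g 0 = 1) {y : A} (hy : y ≠ 0)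
    (hpy : p y = 0) (x : C) :
    f y * pushforward p f x ≤ errorSum p f g x := by
  rw [pushforward, ← ENNReal.tsum_mul_left]
  refine ENNReal.tsum_le_tsum fun x' => ?_
  have hkey : p y = p 0 ∧ y ≠ 0 := ⟨hpy.trans (map_zero p).symm, hy⟩
  calc f y * f x' = f 0 * f (0 - 0) * f (y - 0) * g (p y - p 0) * f (x' - 0) := by
        simp [hf, hg, hpy]
    _ ≤ ∑' z, f z * f (0 - z) * f (y - z) * g (p y - p z) * f (x' - 0) := ENNReal.le_tsum 0
    _ ≤ ∑' y' : {y' // p y' = p 0 ∧ y' ≠ 0}, ∑' z,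
          f z * f (0 - z) * f (y' - z) * g (p y' - p z) * f (x' - 0) :=
        ENNReal.le_tsum (⟨y, hkey⟩ : {y' // p y' = p 0 ∧ y' ≠ 0})
    _ ≤ ∑' y₀, ∑' y' : {y' // p y' = p y₀ ∧ y' ≠ y₀}, ∑' z,
          f z * f (y₀ - z) * f (y' - z) * g (p y' - p z) * f (x' - y₀) := ENNReal.le_tsum 0

theorem errorSum_eq_top (hβ : 0 < β) (hd : 1 ≤ d) [NeZero r] {x : Fin d → ZMod r}
    (h : pushforward (projHom d r) (ENNReal.ofReal ∘ tau d β) x = ∞) :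
    errorSum (projHom d r) (ENNReal.ofReal ∘ tau d β) (ENNReal.ofReal ∘ torusTau d r β) x = ∞ := by
  let y : Fin d → ℤ := (r : ℤ) • Pi.single ⟨0, hd⟩ 1
  have hy : y ≠ 0 := smul_ne_zero (Int.natCast_ne_zero.2 (NeZero.ne r)) (by simp)
  have hpy : projHom d r y = 0 := by
    rw [← map_zero (projHom d r)]
    exact equivalent_iff.1 ⟨_, sub_zero y⟩
  have hle := mul_pushforward_le_errorSum (projHom d r) (f := ENNReal.ofReal ∘ tau d β)
    (g := ENNReal.ofReal ∘ torusTau d r β) (by simp [tau_zero hβ.le])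
    (by simp [torusTau, twoPoint_self hβ.le]) hy hpy x
  rw [h, Function.comp_apply, ENNReal.mul_top (ENNReal.ofReal_pos.2 (tau_pos hβ y)).ne'] at hle
  exact top_le_iff.1 hle

end Final

end IsingTorus

end

theorem theorem2p1 (d : ℕ) (hd : 1 ≤ d) (r : ℕ) [NeZero r] (hr : 3 ≤ r) (β : ℝ) (hβ : 0 < β)
    (x : Fin d → ℤ) (hx : x ∈ IsingTorus.box d r) :
    ENNReal.ofReal (IsingTorus.torusTau d r β (IsingTorus.proj d r x))
        ≤ IsingTorus.unfolded d r β x ∧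
      IsingTorus.unfolded d r β x
          - ENNReal.ofReal (IsingTorus.torusTau d r β (IsingTorus.proj d r x))
        ≤ ∑' x' : {x' : Fin d → ℤ // IsingTorus.Equivalent r x' x},
          ∑' y : Fin d → ℤ,
          ∑' y' : {y' : Fin d → ℤ // IsingTorus.Equivalent r y' y ∧ y' ≠ y},
          ∑' z : Fin d → ℤ,
            ENNReal.ofReal (IsingTorus.tau d β z)
              * ENNReal.ofReal (IsingTorus.tau d β (y - z))
              * ENNReal.ofReal (IsingTorus.tau d β (y'.1 - z))
              * ENNReal.ofReal (IsingTorus.torusTau d r β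
                  (IsingTorus.proj d r y'.1 - IsingTorus.proj d r z))
              * ENNReal.ofReal (IsingTorus.tau d β (x'.1 - y)) := by
  have : Fact (2 < r) := ⟨hr⟩
  have herror := IsingTorus.tsum_equivalent_eq_errorSum (ENNReal.ofReal ∘ IsingTorus.tau d β)
    (ENNReal.ofReal ∘ IsingTorus.torusTau d r β) x
  simp only [Function.comp_apply] at herror
  rw [herror, IsingTorus.unfolded_eq_pushforward (NeZero.ne r)]
  by_cases h : IsingTorus.pushforward (IsingTorus.projHom d r)
      (ENNReal.ofReal ∘ IsingTorus.tau d β) (IsingTorus.projHom d r x) = ∞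
  · rw [IsingTorus.errorSum_eq_top hβ hd h, h]
    exact ⟨le_top, le_top⟩
  · have hχ := IsingTorus.susceptibility_ne_top hβ h
    exact ⟨IsingTorus.ofReal_torusTau_le_pushforward hβ.le hχ _,
      tsub_le_iff_left.2 (IsingTorus.pushforward_le_add_errorSum hβ.le hχ _)⟩
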